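/- Let $n\ge 2$ and $k\ge 2$. Let $\mathcal S_k$ be the space of symmetric contravariant tensor fields of order $k$ on $\mathbb R^n$, i.e. of functions $P(x,\xi)$ on $T^*\mathbb R^n$ that are homogeneous polynomials of degree $k$ in $\xi$ with smooth coefficients in $x$. A vector field $X=X^i\partial_{x^i}\in\mathrm{Vect}(\mathbb R^n)$ is identified with $X^i\xi_i\in\mathcal S_1$ and acts on $\mathcal S_k$ by $L_X=\frac{\partial X}{\partial \xi_i}\frac{\partial}{\partial x^i}-\frac{\partial X}{\partial x^i}\frac{\partial}{\partial \xi_i}$ (repeated indices are summed); it acts on the space $\mathcal D(\mathcal S_k,\mathcal S_\ell)$ of linear differential operators from $\mathcal S_k$ to $\mathcal S_\ell$ by $B\mapsto[L_X,B]=L_X\circ B-B\circ L_X$. Let $\mathrm{sl}(n+1,\mathbb R)\subset\mathrm{Vect}(\mathbb R^n)$ be the span of the fields $\partial_{x^i}$, $x^i\partial_{x^j}$ and $x^i\sum_j x^j\partial_{x^j}$. On functions $F(x,\xi)\,G(y,\eta)$ put $\mathrm D_{(x,\xi)}=\frac{\partial}{\partial x^i}\frac{\partial}{\partial\xi_i}$,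 $\mathrm D_{(x,\eta)}=\frac{\partial}{\partial x^i}\frac{\partial}{\partial\eta_i}$, $\mathrm D_{(y,\xi)}=\frac{\partial}{\partial y^i}\frac{\partial}{\partial\xi_i}$, $\mathrm D_{(y,\eta)}=\frac{\partial}{\partial y^i}\frac{\partial}{\partial\eta_i}$, and define, for $X\in\mathrm{Vect}(\mathbb R^n)$ and $P\in\mathcal S_k$, $$c_1(X)(P)=\Big(\tfrac12\mathrm D_{(x,\eta)}^2-\tfrac{k-1}{n+1}\,\mathrm D_{(x,\xi)}\mathrm D_{(x,\eta)}\Big)\,X(x,\xi)P(y,\eta)\Big|_{y=x,\ \eta=\xi},$$ $$c_2(X)(P)=\Big(\mathrm D_{(x,\eta)}^2\mathrm D_{(y,\eta)}+\tfrac{2k+n+1}{6}\,\mathrm D_{(x,\eta)}^3+\mathrm D_{(x,\xi)}\mathrm D_{(x,\eta)}\mathrm D_{(y,\eta)}+\mathrm D_{(x,\xi)}\mathrm D_{(x,\eta)}^2-\tfrac{2k+n-3}{2}\,\mathrm D_{(y,\xi)}\mathrm D_{(x,\eta)}^2\Big)\,X(x,\xi)P(y,\eta)\Big|_{y=x,\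 \eta=\xi}.$$ Then $c_1$ and $c_2$ are linear maps from $\mathrm{Vect}(\mathbb R^n)$ to $\mathcal D(\mathcal S_k,\mathcal S_{k-1})$ and to $\mathcal D(\mathcal S_k,\mathcal S_{k-2})$ respectively. They are 1-cocycles, $c([X,Y])=[L_X,c(Y)]-[L_Y,c(X)]$, and they vanish on $\mathrm{sl}(n+1,\mathbb R)$. Neither is a coboundary: there is no $B\in\mathcal D(\mathcal S_k,\mathcal S_{k-1})$ with $c_1(X)=[L_X,B]$ for all $X\in\mathrm{Vect}(\mathbb R^n)$, and no $B\in\mathcal D(\mathcal S_k,\mathcal S_{k-2})$ with $c_2(X)=[L_X,B]$ for all $X\in\mathrm{Vect}(\mathbb R^n)$. -/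

import Mathlib

open scoped ContDiff TensorProduct

namespace ProjCocycle

/-- The smooth real functions on `ℝⁿ`, as a subalgebra of all functions. -/
def smoothFun (n : ℕ) : Subalgebra ℝ (EuclideanSpace ℝ (Fin n) → ℝ) where
  carrier := {f | ContDiff ℝ ∞ f}
  mul_mem' := fun {f g} (hf : ContDiff ℝ ∞ f) (hg : ContDiff ℝ ∞ g) =>
    show ContDiff ℝ ∞ fun x => f x * g x from hf.mul hg
  add_mem' := fun {f g} (hf : ContDiff ℝ ∞ f) (hg : ContDiff ℝ ∞ g) =>
    show ContDiff ℝ ∞ fun x => f x + g x from hf.add hg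
  algebraMap_mem' c := show ContDiff ℝ ∞ fun _ => c from contDiff_const

/-- The algebra `C^∞(ℝⁿ)`, with pointwise operations. -/
def Smooth (n : ℕ) : Type := smoothFun n

noncomputable instance (n : ℕ) : CommRing (Smooth n) :=
  inferInstanceAs (CommRing (smoothFun n))

noncomputable instance (n : ℕ) : Algebra ℝ (Smooth n) :=
  inferInstanceAs (Algebra ℝ (smoothFun n))

lemma Smooth.contDiff {n : ℕ} (f : Smooth n) : ContDiff ℝ ∞ f.1 := f.2

/-- The partial derivative `∂/∂x^i` on `C^∞(ℝⁿ)`. -/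
noncomputable def pd {n : ℕ} (i : Fin n) : Smooth n →ₗ[ℝ] Smooth n where
  toFun f := ⟨fun x => fderiv ℝ f.1 x (EuclideanSpace.single i 1),
    (f.contDiff.fderiv_right (m := ∞) (by simp)).clm_apply contDiff_const⟩
  map_add' f g := by
    have hf : Differentiable ℝ f.1 := f.contDiff.differentiable (by simp)
    have hg : Differentiable ℝ g.1 := g.contDiff.differentiable (by simp)
    apply Subtype.ext
    funext x
    change fderiv ℝ (f.1 + g.1) x _ = fderiv ℝ f.1 x _ + fderiv ℝ g.1 x _
    rw [fderiv_add (hf x) (hg x)]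
    rfl
  map_smul' c f := by
    have hf : Differentiable ℝ f.1 := f.contDiff.differentiable (by simp)
    apply Subtype.ext
    funext x
    change fderiv ℝ (c • f.1) x _ = c • fderiv ℝ f.1 x _
    rw [fderiv_const_smul (hf x)]
    rfl

/-- The Lie algebra `Vect(ℝⁿ)` of smooth vector fields on `ℝⁿ` (as a real vector space). -/
def Vect (n : ℕ) :
    Submodule ℝ (EuclideanSpace ℝ (Fin n) → EuclideanSpace ℝ (Fin n)) where
  carrier := {X | ContDiff ℝ ∞ X}
  add_mem' := fun {X Y} (hX : ContDiff ℝ ∞ X) (hY : ContDiff ℝ ∞ Y) =>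
    show ContDiff ℝ ∞ fun x => X x + Y x from hX.add hY
  zero_mem' := show ContDiff ℝ ∞ fun _ => 0 from contDiff_const
  smul_mem' := fun c X (hX : ContDiff ℝ ∞ X) =>
    show ContDiff ℝ ∞ fun x => c • X x from hX.const_smul c

lemma contDiff_of_vect {n : ℕ} (X : Vect n) : ContDiff ℝ ∞ X.1 := X.2

/-- The Lie bracket of vector fields, `[X, Y]^j = X^i ∂_i Y^j - Y^i ∂_i X^j`. -/
noncomputable instance (n : ℕ) : Bracket (Vect n) (Vect n) where
  bracket X Y := ⟨VectorField.lieBracket ℝ X.1 Y.1,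
    (contDiff_of_vect X).lieBracket_vectorField (m := ∞) (contDiff_of_vect Y) (by simp)⟩

/-- The component `X^i` of a vector field. -/
def comp {n : ℕ} (X : Vect n) (i : Fin n) : Smooth n :=
  ⟨fun x => X.1 x i, contDiff_euclidean.1 (contDiff_of_vect X) i⟩

/-- The space `𝒮` of symmetric contravariant tensor fields on `ℝⁿ`, as functions on `T^*ℝⁿ`
polynomial on the fibres: polynomials in `ξ_1, …, ξ_n` with coefficients in `C^∞(ℝⁿ)`. -/
abbrev S (n : ℕ) : Type := MvPolynomial (Fin n) (Smooth n)

/-- The space `𝒮_k` of tensor fields of order `k`: homogeneous of degree `k` in `ξ`. -/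
abbrev Sk (n k : ℕ) : Type := MvPolynomial.homogeneousSubmodule (Fin n) (Smooth n) k

/-- `∂/∂x^i` on `𝒮`, acting on the coefficients. -/
noncomputable def dx {n : ℕ} (i : Fin n) : S n →ₗ[ℝ] S n where
  toFun P := AddMonoidAlgebra.map (pd i).toAddMonoidHom P
  map_add' P Q := by
    apply MvPolynomial.ext
    intro m
    simp only [MvPolynomial.coeff_add, MvPolynomial.coeff_addMonoidAlgebraMap, map_add]
  map_smul' c P := by
    apply MvPolynomial.ext
    intro m
    simp only [MvPolynomial.coeff_smul, MvPolynomial.coeff_addMonoidAlgebraMap, RingHom.id_apply]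
    exact (pd i).map_smul c _

/-- `∂/∂ξ_i` on `𝒮`. -/
noncomputable def dxi {n : ℕ} (i : Fin n) : S n →ₗ[ℝ] S n :=
  (MvPolynomial.pderiv (R := Smooth n) i).toLinearMap.restrictScalars ℝ

lemma dx_isHomogeneous {n k : ℕ} (i : Fin n) {P : S n} (hP : P.IsHomogeneous k) :
    (dx i P).IsHomogeneous k := by
  intro m hm
  apply hP
  intro h
  apply hm
  change pd i (MvPolynomial.coeff m P) = 0
  rw [h, map_zero]

lemma dxi_isHomogeneous {n k : ℕ} (i : Fin n) {P : S n} (hP : P.IsHomogeneous k) :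
    (dxi i P).IsHomogeneous (k - 1) :=
  hP.pderiv

/-- A vector field `X` regarded as the first-order polynomial `X^i ξ_i`. -/
noncomputable def symb {n : ℕ} (X : Vect n) : S n :=
  ∑ i, MvPolynomial.C (comp X i) * MvPolynomial.X i

lemma symb_isHomogeneous {n : ℕ} (X : Vect n) : (symb X).IsHomogeneous 1 := by
  apply MvPolynomial.IsHomogeneous.sum
  intro i _
  simpa using (MvPolynomial.isHomogeneous_C (Fin n) (comp X i)).mul
    (MvPolynomial.isHomogeneous_X (Smooth n) i)

/-- The action of `X` on `𝒮` by the Hamiltonian vector field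
`L_X = ∂X/∂ξ_i ∂/∂x^i - ∂X/∂x^i ∂/∂ξ_i`. -/
noncomputable def lieS {n : ℕ} (X : Vect n) : S n →ₗ[ℝ] S n :=
  ∑ i, (LinearMap.mulLeft ℝ (dxi i (symb X)) ∘ₗ dx i
    - LinearMap.mulLeft ℝ (dx i (symb X)) ∘ₗ dxi i)

lemma lieS_isHomogeneous {n k : ℕ} (X : Vect n) {P : S n} (hP : P.IsHomogeneous k) :
    (lieS X P).IsHomogeneous k := by
  simp only [lieS, LinearMap.sum_apply, LinearMap.sub_apply, LinearMap.comp_apply,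
    LinearMap.mulLeft_apply]
  apply MvPolynomial.IsHomogeneous.sum
  intro i _
  apply MvPolynomial.IsHomogeneous.sub
  · simpa using (dxi_isHomogeneous i (symb_isHomogeneous X)).mul (dx_isHomogeneous i hP)
  · have h := (dx_isHomogeneous i (symb_isHomogeneous X)).mul (dxi_isHomogeneous i hP)
    rcases k with _ | k
    · have h0 : dxi i P = 0 := by
        rw [MvPolynomial.totalDegree_eq_zero_iff_eq_C.1
          (Nat.le_zero.1 hP.totalDegree_le)]
        exact MvPolynomial.pderiv_C
      rw [h0, mul_zero]
      exact MvPolynomial.isHomogeneous_zero _ _ _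
    · rwa [Nat.add_sub_cancel, Nat.add_comm] at h

/-- The action `L_X` on `𝒮_k`. -/
noncomputable def lieSk {n : ℕ} (k : ℕ) (X : Vect n) : Sk n k →ₗ[ℝ] Sk n k where
  toFun P := ⟨lieS X P.1, lieS_isHomogeneous X P.2⟩
  map_add' P Q := Subtype.ext (map_add (lieS X) P.1 Q.1)
  map_smul' c P := Subtype.ext (map_smul (lieS X) c P.1)

/-- `∂/∂x^i` on `𝒮_k`. -/
noncomputable def dxk {n : ℕ} (k : ℕ) (i : Fin n) : Sk n k →ₗ[ℝ] Sk n k where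
  toFun P := ⟨dx i P.1, dx_isHomogeneous i P.2⟩
  map_add' P Q := Subtype.ext (map_add (dx i) P.1 Q.1)
  map_smul' c P := Subtype.ext (map_smul (dx i) c P.1)

/-- The space `𝒟(𝒮_k, 𝒮_ℓ)` of linear differential operators: the finite sums of operators
`P ↦ b (∂_{i₁} ⋯ ∂_{i_r} P)` with `b : 𝒮_k → 𝒮_ℓ` linear over `C^∞(ℝⁿ)`. -/
noncomputable def DiffOp (n k l : ℕ) : Submodule ℝ (Sk n k →ₗ[ℝ] Sk n l) :=
  Submodule.span ℝ {T | ∃ (b : Sk n k →ₗ[Smooth n] Sk n l) (I : List (Fin n)),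
    T = b.restrictScalars ℝ ∘ₗ (I.map (dxk k)).prod}

/-- The action of `X` on linear maps `𝒮_k → 𝒮_ℓ`: `[L_X, B] = L_X ∘ B - B ∘ L_X`. -/
noncomputable def act {n k l : ℕ} (X : Vect n) (B : Sk n k →ₗ[ℝ] Sk n l) :
    Sk n k →ₗ[ℝ] Sk n l :=
  lieSk l X ∘ₗ B - B ∘ₗ lieSk k X

/-- `c` is a 1-cocycle on `Vect(ℝⁿ)` with values in `𝒟(𝒮_k, 𝒮_ℓ)`. -/
def IsOneCocycle {n k l : ℕ} (c : Vect n →ₗ[ℝ] DiffOp n k l) : Prop :=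
  ∀ X Y : Vect n, (c ⁅X, Y⁆).1 = act X (c Y).1 - act Y (c X).1

/-- `c` is a 1-coboundary on `Vect(ℝⁿ)` with values in `𝒟(𝒮_k, 𝒮_ℓ)`. -/
def IsOneCoboundary {n k l : ℕ} (c : Vect n →ₗ[ℝ] DiffOp n k l) : Prop :=
  ∃ B : DiffOp n k l, ∀ X : Vect n, (c X).1 = act X B.1

/-- The subalgebra `sl(n+1, ℝ)` of `Vect(ℝⁿ)`, spanned by the fields
`∂/∂x^i`, `x^i ∂/∂x^j` and `x^i ℰ`, where `ℰ = x^j ∂/∂x^j`. -/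
def slAlg (n : ℕ) : Submodule ℝ (Vect n) :=
  Submodule.span ℝ {X |
    (∃ i : Fin n, ∀ x, X.1 x = EuclideanSpace.single i 1) ∨
    (∃ i j : Fin n, ∀ x, X.1 x = x i • EuclideanSpace.single j 1) ∨
    (∃ i : Fin n, ∀ x, X.1 x = x i • x)}

/-! The invariant operators on `𝒮 ⊗ 𝒮`; the variables of the first factor are `(x, ξ)`, those
of the second are `(y, η)`. -/

/-- `D_{(x,ξ)} = ∂/∂x^i ∂/∂ξ_i`. -/
noncomputable def Dxxi (n : ℕ) : Module.End ℝ (S n ⊗[ℝ] S n) :=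
  ∑ i, TensorProduct.map (dx i ∘ₗ dxi i) LinearMap.id

/-- `D_{(x,η)} = ∂/∂x^i ∂/∂η_i`. -/
noncomputable def Dxeta (n : ℕ) : Module.End ℝ (S n ⊗[ℝ] S n) :=
  ∑ i, TensorProduct.map (dx i) (dxi i)

/-- `D_{(y,ξ)} = ∂/∂y^i ∂/∂ξ_i`. -/
noncomputable def Dyxi (n : ℕ) : Module.End ℝ (S n ⊗[ℝ] S n) :=
  ∑ i, TensorProduct.map (dxi i) (dx i)

/-- `D_{(y,η)} = ∂/∂y^i ∂/∂η_i`. -/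
noncomputable def Dyeta (n : ℕ) : Module.End ℝ (S n ⊗[ℝ] S n) :=
  ∑ i, TensorProduct.map LinearMap.id (dx i ∘ₗ dxi i)

/-- Apply `T` to `F(x,ξ) G(y,η)` and restrict to the diagonal `y = x`, `η = ξ`. -/
noncomputable def onDiag {n : ℕ} (T : Module.End ℝ (S n ⊗[ℝ] S n)) (F G : S n) : S n :=
  LinearMap.mul' ℝ (S n) (T (F ⊗ₜ[ℝ] G))

/-- `½ D_{(x,η)}² - (k-1)/(n+1) D_{(x,ξ)} D_{(x,η)}`. -/
noncomputable def C₁ (n k : ℕ) : Module.End ℝ (S n ⊗[ℝ] S n) :=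
  (1 / 2 : ℝ) • Dxeta n ^ 2 - (((k : ℝ) - 1) / ((n : ℝ) + 1)) • (Dxxi n * Dxeta n)

/-- The operator
`∑_{s=2}^{3} (α_s / (s! (3-s)!) D_{(x,η)}^s D_{(y,η)}^{3-s}
  + β_s / ((s-1)! (3-s)!) D_{(x,ξ)} D_{(x,η)}^{s-1} D_{(y,η)}^{3-s})
  + γ₂ / (2! 0!) D_{(y,ξ)} D_{(x,η)}²`
with `α₂ = 2`, `α₃ = 2k+n+1`, `β₂ = 1`, `β₃ = 2`, `γ₂ = -(2k+n-3)`. -/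
noncomputable def C₂ (n k : ℕ) : Module.End ℝ (S n ⊗[ℝ] S n) :=
  (2 / 2 : ℝ) • (Dxeta n ^ 2 * Dyeta n)
    + ((2 * (k : ℝ) + (n : ℝ) + 1) / 6) • Dxeta n ^ 3
    + (1 : ℝ) • (Dxxi n * Dxeta n * Dyeta n)
    + (2 / 2 : ℝ) • (Dxxi n * Dxeta n ^ 2)
    + (-(2 * (k : ℝ) + (n : ℝ) - 3) / 2) • (Dyxi n * Dxeta n ^ 2)

end ProjCocycle

/-!
The operators are treated as polynomials in the four commuting operators `a = D_{(x,ξ)}`,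
`b = D_{(x,η)}`, `c = D_{(y,ξ)}`, `d = D_{(y,η)}` on `𝒮 ⊗ 𝒮`. The Poisson bracket is the restriction
to the diagonal of `p = c - b`, the Lie derivative is `L_X P = {X, P}`, and `Div` composed with the
restriction to the diagonal is `a + b + c + d`. Since a vector field is linear in `ξ`, the operators
`a²`, `a c` and `c²` annihilate `X ⊗ P`. Modulo these relations, writing `Δ` for `Div`,

* `c₁(X) = ½ [L_X, Δ] + (½ + (k-1)/(n+1)) {Δ X, ·}` (`onDiag_C₁_eq`),
* `c₂(X) = ½ [L_X, Δ²] - (2k+n-2)/6 p³(X, ·)` (`onDiag_C₂_eq`).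

The first terms are coboundaries. The second term of `c₁` is a cocycle by the Jacobi identity and
because `Δ` is a cocycle on vector fields (`divS_lieS_symb`). The second term of `c₂` is a cocycle
because the third order bracket `p³` is a 2-cocycle of the Poisson bracket (`poisson_cube_cocycle`)
that vanishes on pairs of vector fields. Both the Jacobi identity and the cocycle identity of `p³`
are polynomial identities in the three commuting Poisson operators on `𝒮 ⊗ (𝒮 ⊗ 𝒮)`.

On `sl(n+1, ℝ)` only the second derivatives of `X = x^i x^j ξ_j` contribute, and Euler's identity
in `ξ` makes the terms cancel.

If `B` is a primitive of one of the cocycles, then `B` commutes with `sl(n+1, ℝ)`. Comparing degrees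
under translations and dilations, `B` annihilates the fields of low degree in `x`
(`apply_eq_zero_of_euler`). Evaluating `c(X) = [L_X, B]` on monomials then determines further values
of `B` in two incompatible ways (`not_coboundary_C₁`, `not_coboundary_C₂`).
-/

namespace ProjCocycle

variable {n : ℕ}

/-! ### Partial derivatives on smooth functions and on tensor fields -/

lemma Smooth.ext {f g : Smooth n} (h : ∀ x, f.1 x = g.1 x) : f = g :=
  Subtype.ext (funext h)

lemma Smooth.differentiable (f : Smooth n) : Differentiable ℝ f.1 :=
  f.contDiff.differentiable (by simp)

lemma pd_mul (i : Fin n) (f g : Smooth n) : pd i (f * g) = pd i f * g + f * pd i g := by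
  apply Smooth.ext
  intro x
  change fderiv ℝ (f.1 * g.1) x _ = fderiv ℝ f.1 x _ * g.1 x + f.1 x * fderiv ℝ g.1 x _
  rw [fderiv_mul (f.differentiable x) (g.differentiable x)]
  simp only [add_apply, smul_apply, smul_eq_mul]
  ring

lemma pd_comm (i j : Fin n) (f : Smooth n) : pd i (pd j f) = pd j (pd i f) := by
  have hf : ∀ x, DifferentiableAt ℝ (fderiv ℝ f.1) x := fun x =>
    ((f.contDiff.fderiv_right (m := ∞) (by simp)).differentiable (by simp)) x
  have key : ∀ (a b : Fin n) x, (pd a (pd b f)).1 x =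
      fderiv ℝ (fderiv ℝ f.1) x (EuclideanSpace.single a 1) (EuclideanSpace.single b 1) := by
    intro a b x
    change fderiv ℝ (fun y => fderiv ℝ f.1 y (EuclideanSpace.single b 1)) x _ = _
    rw [fderiv_clm_apply (hf x) (differentiableAt_const _)]
    simp
  apply Smooth.ext
  intro x
  rw [key, key]
  exact (f.contDiff.contDiffAt (x := x)).isSymmSndFDerivAt
    (by simpa using WithTop.coe_le_coe.2 (le_top (a := (2 : ℕ∞)))) _ _

lemma coeff_dx (i : Fin n) (P : S n) (m : Fin n →₀ ℕ) :
    MvPolynomial.coeff m (dx i P) = pd i (MvPolynomial.coeff m P) := rfl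

lemma dx_mul (i : Fin n) (P Q : S n) : dx i (P * Q) = dx i P * Q + P * dx i Q := by
  apply MvPolynomial.ext
  intro m
  simp only [coeff_dx, MvPolynomial.coeff_add, MvPolynomial.coeff_mul, map_sum, pd_mul,
    Finset.sum_add_distrib]

lemma dxi_mul (i : Fin n) (P Q : S n) : dxi i (P * Q) = dxi i P * Q + P * dxi i Q :=
  MvPolynomial.pderiv_mul

lemma dx_comm (i j : Fin n) (P : S n) : dx i (dx j P) = dx j (dx i P) := by
  apply MvPolynomial.ext
  intro m
  simp only [coeff_dx, pd_comm i j]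

lemma coeff_dxi (i : Fin n) (P : S n) (m : Fin n →₀ ℕ) :
    MvPolynomial.coeff m (dxi i P) =
      (m i + 1) • MvPolynomial.coeff (m + Finsupp.single i 1) P := by
  rw [show dxi i P = MvPolynomial.pderiv i P from rfl, MvPolynomial.coeff_pderiv, nsmul_eq_mul,
    mul_comm]
  push_cast
  rfl

lemma dxi_comm (i j : Fin n) (P : S n) : dxi i (dxi j P) = dxi j (dxi i P) := by
  apply MvPolynomial.ext
  intro m
  rcases eq_or_ne i j with rfl | h
  · rfl
  simp only [coeff_dxi, smul_smul, Finsupp.add_apply, Finsupp.single_eq_of_ne h,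
    Finsupp.single_eq_of_ne h.symm, add_zero]
  rw [mul_comm, add_right_comm]

lemma dx_dxi_comm (i j : Fin n) (P : S n) : dx i (dxi j P) = dxi j (dx i P) := by
  apply MvPolynomial.ext
  intro m
  simp only [coeff_dx, coeff_dxi, map_nsmul]

lemma pd_one (i : Fin n) : pd i (1 : Smooth n) = 0 := by
  have h := pd_mul i (1 : Smooth n) 1
  simpa using h

lemma dx_C (i : Fin n) (f : Smooth n) : dx i (MvPolynomial.C f) = MvPolynomial.C (pd i f) := by
  apply MvPolynomial.ext
  intro m
  simp only [coeff_dx, MvPolynomial.coeff_C]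
  split_ifs <;> simp

lemma dx_X (i j : Fin n) : dx i (MvPolynomial.X j : S n) = 0 := by
  apply MvPolynomial.ext
  intro m
  simp only [coeff_dx, MvPolynomial.coeff_X, MvPolynomial.coeff_zero]
  split_ifs <;> simp [pd_one]

lemma dx_C_mul_X (i j : Fin n) (f : Smooth n) :
    dx i (MvPolynomial.C f * MvPolynomial.X j) = MvPolynomial.C (pd i f) * MvPolynomial.X j := by
  rw [dx_mul, dx_C, dx_X, mul_zero, add_zero]

lemma dxi_C (i : Fin n) (f : Smooth n) : dxi i (MvPolynomial.C f) = 0 :=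
  MvPolynomial.pderiv_C

lemma dxi_C_mul (i : Fin n) (f : Smooth n) (P : S n) :
    dxi i (MvPolynomial.C f * P) = MvPolynomial.C f * dxi i P :=
  MvPolynomial.pderiv_C_mul

lemma dxi_X (i j : Fin n) : dxi i (MvPolynomial.X j : S n) = if i = j then 1 else 0 := by
  rw [show dxi i (MvPolynomial.X j : S n) = MvPolynomial.pderiv i (MvPolynomial.X j) from rfl,
    MvPolynomial.pderiv_X, Pi.single_apply]
  simp [eq_comm]

lemma dxi_symb (i : Fin n) (X : Vect n) : dxi i (symb X) = MvPolynomial.C (comp X i) := by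
  simp [symb, map_sum, dxi_C_mul, dxi_X]

lemma dx_symb (i : Fin n) (X : Vect n) :
    dx i (symb X) = ∑ j, MvPolynomial.C (pd i (comp X j)) * MvPolynomial.X j := by
  simp [symb, map_sum, dx_C_mul_X]

/-- Two derivatives along the fibre annihilate a vector field. -/
lemma dxi_dxi_symb (i j : Fin n) (X : Vect n) : dxi i (dxi j (symb X)) = 0 := by
  rw [dxi_symb, dxi_C]

lemma symb_add (X Y : Vect n) : symb (X + Y) = symb X + symb Y := by
  have h : ∀ i, comp (X + Y) i = comp X i + comp Y i := fun i => rfl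
  simp [symb, h, add_mul, Finset.sum_add_distrib]

lemma symb_smul (c : ℝ) (X : Vect n) : symb (c • X) = c • symb X := by
  have h : ∀ i, comp (c • X) i = c • comp X i := fun i => rfl
  rw [symb, symb, Finset.smul_sum]
  refine Finset.sum_congr rfl fun i _ => ?_
  rw [h, MvPolynomial.C_mul', MvPolynomial.C_mul', smul_assoc]

lemma pd_comp (i j : Fin n) (X : Vect n) (x : EuclideanSpace ℝ (Fin n)) :
    (pd i (comp X j)).1 x = fderiv ℝ X.1 x (EuclideanSpace.single i 1) j := by
  have hX : DifferentiableAt ℝ X.1 x := (contDiff_of_vect X).differentiable (by simp) x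
  change fderiv ℝ (fun y => X.1 y j) x _ = _
  have h := (EuclideanSpace.proj (𝕜 := ℝ) j).hasFDerivAt.comp x hX.hasFDerivAt
  have h' : HasFDerivAt (fun y => X.1 y j)
    ((EuclideanSpace.proj (𝕜 := ℝ) j).comp (fderiv ℝ X.1 x)) x := h
  rw [h'.fderiv]
  rfl

lemma smooth_sum_apply {ι : Type*} (s : Finset ι) (f : ι → Smooth n)
    (x : EuclideanSpace ℝ (Fin n)) : (∑ i ∈ s, f i).1 x = ∑ i ∈ s, (f i).1 x := by
  classical
  induction s using Finset.induction_on with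
  | empty => rfl
  | insert a s ha ih =>
    rw [Finset.sum_insert ha, Finset.sum_insert ha, ← ih]
    rfl

lemma comp_bracket (X Y : Vect n) (j : Fin n) :
    comp ⁅X, Y⁆ j = ∑ i, (comp X i * pd i (comp Y j) - pd i (comp X j) * comp Y i) := by
  apply Smooth.ext
  intro x
  have key : ∀ (V W : Vect n), fderiv ℝ W.1 x (V.1 x) j =
      ∑ i, V.1 x i * (pd i (comp W j)).1 x := by
    intro V W
    have hV : V.1 x = ∑ i, V.1 x i • EuclideanSpace.single i (1 : ℝ) := by
      ext k
      simp [Pi.single_apply]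
    conv_lhs => rw [hV]
    simp [map_sum, pd_comp]
  rw [smooth_sum_apply]
  change VectorField.lieBracket ℝ X.1 Y.1 x j = ∑ i, (X.1 x i * (pd i (comp Y j)).1 x -
    (pd i (comp X j)).1 x * Y.1 x i)
  rw [VectorField.lieBracket]
  change fderiv ℝ Y.1 x (X.1 x) j - fderiv ℝ X.1 x (Y.1 x) j = _
  rw [key, key, ← Finset.sum_sub_distrib]
  exact Finset.sum_congr rfl fun i _ => by ring

lemma lieS_apply (X : Vect n) (P : S n) :
    lieS X P = ∑ i, (dxi i (symb X) * dx i P - dx i (symb X) * dxi i P) := by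
  simp [lieS]

/-- The Lie bracket of vector fields is the Poisson bracket of their symbols. -/
lemma symb_bracket (X Y : Vect n) : symb ⁅X, Y⁆ = lieS X (symb Y) := by
  rw [lieS_apply]
  simp only [dxi_symb, dx_symb, Finset.mul_sum, Finset.sum_mul, Finset.sum_sub_distrib]
  simp only [symb, comp_bracket, map_sum, map_sub, map_mul, Finset.sum_mul, sub_mul,
    Finset.sum_sub_distrib]
  refine congrArg₂ (· - ·) ?_ ?_ <;>
  · rw [Finset.sum_comm]
    exact Finset.sum_congr rfl fun i _ => Finset.sum_congr rfl fun j _ => by ring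

/-! ### Bidifferential operators with constant coefficients -/

section Diagonal

variable (T T' : Module.End ℝ (S n ⊗[ℝ] S n)) (F F' G : S n) (c : ℝ)

lemma onDiag_add : onDiag (T + T') F G = onDiag T F G + onDiag T' F G := by simp [onDiag]

lemma onDiag_sub : onDiag (T - T') F G = onDiag T F G - onDiag T' F G := by simp [onDiag]

lemma onDiag_smul : onDiag (c • T) F G = c • onDiag T F G := by simp [onDiag]

lemma onDiag_add_left : onDiag T (F + F') G = onDiag T F G + onDiag T F' G := by
  simp [onDiag, TensorProduct.add_tmul]

lemma onDiag_smul_left : onDiag T (c • F) G = c • onDiag T F G := by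
  rw [onDiag, onDiag, ← TensorProduct.smul_tmul', map_smul, map_smul]

end Diagonal

lemma commute_dx_dx (i j : Fin n) : Commute (S := Module.End ℝ (S n)) (dx i) (dx j) :=
  LinearMap.ext fun P => dx_comm i j P

lemma commute_dxi_dxi (i j : Fin n) : Commute (S := Module.End ℝ (S n)) (dxi i) (dxi j) :=
  LinearMap.ext fun P => dxi_comm i j P

lemma commute_dx_dxi (i j : Fin n) : Commute (S := Module.End ℝ (S n)) (dx i) (dxi j) :=
  LinearMap.ext fun P => dx_dxi_comm i j P

lemma commute_dxi_dx (i j : Fin n) : Commute (S := Module.End ℝ (S n)) (dxi i) (dx j) :=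
  (commute_dx_dxi j i).symm

lemma commute_sum_map {M N ι : Type*} [Fintype ι] [AddCommGroup M] [AddCommGroup N]
    [Module ℝ M] [Module ℝ N] {u u' : ι → Module.End ℝ M} {v v' : ι → Module.End ℝ N}
    (hu : ∀ i j, Commute (u i) (u' j)) (hv : ∀ i j, Commute (v i) (v' j)) :
    Commute (S := Module.End ℝ (M ⊗[ℝ] N)) (∑ i, TensorProduct.map (u i) (v i))
      (∑ i, TensorProduct.map (u' i) (v' i)) := by
  refine Commute.sum_left _ _ _ fun i _ => Commute.sum_right _ _ _ fun j _ => ?_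
  change _ * _ = _ * _
  rw [← TensorProduct.map_mul, ← TensorProduct.map_mul, (hu i j).eq, (hv i j).eq]

lemma commute_dx_dx_dxi (i j : Fin n) :
    Commute (S := Module.End ℝ (S n)) (dx i) (dx j ∘ₗ dxi j) :=
  (commute_dx_dx i j).mul_right (commute_dx_dxi i j)

lemma commute_dxi_dx_dxi (i j : Fin n) :
    Commute (S := Module.End ℝ (S n)) (dxi i) (dx j ∘ₗ dxi j) :=
  (commute_dxi_dx i j).mul_right (commute_dxi_dxi i j)

lemma commute_id_end {M : Type*} [AddCommGroup M] [Module ℝ M] (u : Module.End ℝ M) :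
    Commute (S := Module.End ℝ M) LinearMap.id u := Commute.one_left u

lemma commute_end_id {M : Type*} [AddCommGroup M] [Module ℝ M] (u : Module.End ℝ M) :
    Commute (S := Module.End ℝ M) u LinearMap.id := Commute.one_right u

lemma commute_Dxeta_Dxxi : Commute (Dxeta n) (Dxxi n) :=
  commute_sum_map commute_dx_dx_dxi fun _ _ => commute_end_id _

lemma commute_Dyxi_Dxxi : Commute (Dyxi n) (Dxxi n) :=
  commute_sum_map commute_dxi_dx_dxi fun _ _ => commute_end_id _

lemma commute_Dyeta_Dxxi : Commute (Dyeta n) (Dxxi n) :=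
  commute_sum_map (fun _ _ => commute_id_end _) fun _ _ => commute_end_id _

lemma commute_Dyxi_Dxeta : Commute (Dyxi n) (Dxeta n) :=
  commute_sum_map commute_dxi_dx commute_dx_dxi

lemma commute_Dyeta_Dxeta : Commute (Dyeta n) (Dxeta n) :=
  commute_sum_map (fun _ _ => commute_id_end _) fun i j => (commute_dxi_dx_dxi j i).symm

lemma commute_Dyeta_Dyxi : Commute (Dyeta n) (Dyxi n) :=
  commute_sum_map (fun _ _ => commute_id_end _) fun i j => (commute_dx_dx_dxi j i).symm

/-! ### The Poisson bracket and the divergence -/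

/-- The bidifferential operator `D_{(y,ξ)} - D_{(x,η)}`, whose restriction to the diagonal is the
Poisson bracket on `T^*ℝⁿ`. -/
noncomputable def poissonOp (n : ℕ) : Module.End ℝ (S n ⊗[ℝ] S n) := Dyxi n - Dxeta n

/-- The divergence `Div = ∂/∂x^i ∂/∂ξ_i` on tensor fields. -/
noncomputable def divS (n : ℕ) : Module.End ℝ (S n) := ∑ i, dx i ∘ₗ dxi i

lemma lieS_eq_onDiag (X : Vect n) (P : S n) : lieS X P = onDiag (poissonOp n) (symb X) P := by
  simp [lieS_apply, onDiag, poissonOp, Dyxi, Dxeta, LinearMap.sum_apply]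

lemma divS_mul' : divS n ∘ₗ LinearMap.mul' ℝ (S n) =
    LinearMap.mul' ℝ (S n) ∘ₗ (Dxxi n + Dxeta n + Dyxi n + Dyeta n) := by
  apply TensorProduct.ext'
  intro F G
  simp only [divS, Dxxi, Dxeta, Dyxi, Dyeta, LinearMap.comp_apply, LinearMap.sum_apply,
    LinearMap.mul'_apply, LinearMap.add_apply, map_add, map_sum, TensorProduct.map_tmul,
    LinearMap.id_apply, dxi_mul, dx_mul, ← Finset.sum_add_distrib]
  exact Finset.sum_congr rfl fun i _ => by ring

/-- The divergence of a product is the sum of the four contractions. -/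
lemma divS_onDiag (T : Module.End ℝ (S n ⊗[ℝ] S n)) (F G : S n) :
    divS n (onDiag T F G) = onDiag ((Dxxi n + Dxeta n + Dyxi n + Dyeta n) * T) F G :=
  LinearMap.congr_fun divS_mul' (T (F ⊗ₜ G))

lemma Dyeta_tmul (F G : S n) : Dyeta n (F ⊗ₜ G) = F ⊗ₜ divS n G := by
  simp [Dyeta, divS, LinearMap.sum_apply, TensorProduct.tmul_sum]

lemma Dxxi_tmul (F G : S n) : Dxxi n (F ⊗ₜ G) = divS n F ⊗ₜ G := by
  simp [Dxxi, divS, LinearMap.sum_apply, TensorProduct.sum_tmul]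

/-- A divergence in the second argument is a factor `D_{(y,η)}` on the right. -/
lemma onDiag_divS_right (T : Module.End ℝ (S n ⊗[ℝ] S n)) (F G : S n) :
    onDiag T F (divS n G) = onDiag (T * Dyeta n) F G := by
  rw [onDiag, onDiag, Module.End.mul_apply, Dyeta_tmul]

/-- A divergence in the first argument is a factor `D_{(x,ξ)}` on the right. -/
lemma onDiag_divS_left (T : Module.End ℝ (S n ⊗[ℝ] S n)) (F G : S n) :
    onDiag T (divS n F) G = onDiag (T * Dxxi n) F G := by
  rw [onDiag, onDiag, Module.End.mul_apply, Dxxi_tmul]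

/-! ### Symbols of vector fields -/

lemma sum_map_mul_sum_map {M N ι : Type*} [Fintype ι] [AddCommGroup M] [AddCommGroup N]
    [Module ℝ M] [Module ℝ N] (u u' : ι → Module.End ℝ M) (v v' : ι → Module.End ℝ N)
    (F : M) (G : N) :
    ((∑ i, TensorProduct.map (u i) (v i) : Module.End ℝ (M ⊗[ℝ] N)) *
      ∑ i, TensorProduct.map (u' i) (v' i)) (F ⊗ₜ G) =
      ∑ j, ∑ i, u i (u' j F) ⊗ₜ[ℝ] v i (v' j G) := by
  simp [LinearMap.sum_apply]

lemma onDiag_mul_of_apply_eq_zero {T T' : Module.End ℝ (S n ⊗[ℝ] S n)} {F G : S n}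
    (h : T' (F ⊗ₜ G) = 0) : onDiag (T * T') F G = 0 := by
  rw [onDiag, Module.End.mul_apply, h, map_zero, map_zero]

section VectorField

variable (X Y : Vect n) (P : S n)

lemma Dyxi_sq_symb : (Dyxi n * Dyxi n) (symb X ⊗ₜ P) = 0 := by
  simp only [Dyxi, sum_map_mul_sum_map, dxi_dxi_symb, TensorProduct.zero_tmul,
    Finset.sum_const_zero]

lemma Dyxi_Dxxi_symb : (Dyxi n * Dxxi n) (symb X ⊗ₜ P) = 0 := by
  simp only [Dyxi, Dxxi, sum_map_mul_sum_map, LinearMap.comp_apply, ← dx_dxi_comm, dxi_dxi_symb,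
    map_zero, TensorProduct.zero_tmul, Finset.sum_const_zero]

lemma Dxxi_sq_symb : (Dxxi n * Dxxi n) (symb X ⊗ₜ P) = 0 := by
  simp only [Dxxi, sum_map_mul_sum_map, LinearMap.comp_apply, ← dx_dxi_comm, dxi_dxi_symb,
    map_zero, TensorProduct.zero_tmul, Finset.sum_const_zero]

lemma Dxeta_sq_symb : (Dxeta n * Dxeta n) (P ⊗ₜ symb X) = 0 := by
  simp only [Dxeta, sum_map_mul_sum_map, dxi_dxi_symb, TensorProduct.tmul_zero,
    Finset.sum_const_zero]

end VectorField

universe u in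
open scoped IsMulCommutative in
/-- Commuting elements of a ring lie in the image of a commutative ring, so that polynomial
identities between them may be checked there. -/
lemma exists_commRing_of_commute {A : Type u} [Ring A] {a b c d : A} (hab : Commute a b)
    (hac : Commute a c) (had : Commute a d) (hbc : Commute b c) (hbd : Commute b d)
    (hcd : Commute c d) :
    ∃ (R : Type u) (_ : CommRing R) (φ : R →+* A) (a' b' c' d' : R),
      φ a' = a ∧ φ b' = b ∧ φ c' = c ∧ φ d' = d := by
  have hs : ∀ x ∈ ({a, b, c, d} : Set A), ∀ y ∈ ({a, b, c, d} : Set A), x * y = y * x := by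
    rintro x (rfl | rfl | rfl | rfl) y (rfl | rfl | rfl | rfl)
    all_goals first
      | rfl
      | (apply Commute.eq; assumption)
      | (apply Commute.eq; apply Commute.symm; assumption)
  have := Algebra.isMulCommutative_adjoin ℤ hs
  exact ⟨Algebra.adjoin ℤ {a, b, c, d}, inferInstance, (Algebra.adjoin ℤ {a, b, c, d}).val,
    ⟨a, Algebra.subset_adjoin (by simp)⟩, ⟨b, Algebra.subset_adjoin (by simp)⟩,
    ⟨c, Algebra.subset_adjoin (by simp)⟩, ⟨d, Algebra.subset_adjoin (by simp)⟩,
    rfl, rfl, rfl, rfl⟩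

/-- A commutative ring in which identities between the four bidifferential operators can be checked.
Compatibility of `φ` with subtraction is stated for the subtraction of linear maps. -/
lemma exists_commRing_bidiff (n : ℕ) :
    ∃ (R : Type) (_ : CommRing R) (φ : R →+* Module.End ℝ (S n ⊗[ℝ] S n)) (a b c d : R),
      Dxxi n = φ a ∧ Dxeta n = φ b ∧ Dyxi n = φ c ∧ Dyeta n = φ d ∧
      ∀ x y, φ x - φ y = φ (x - y) := by
  obtain ⟨R, h, φ, a, b, c, d, ha, hb, hc, hd⟩ := exists_commRing_of_commute
    (A := Module.End ℝ (S n ⊗[ℝ] S n)) (commute_Dxeta_Dxxi (n := n)).symm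
    commute_Dyxi_Dxxi.symm commute_Dyeta_Dxxi.symm
    commute_Dyxi_Dxeta.symm commute_Dyeta_Dxeta.symm commute_Dyeta_Dyxi.symm
  exact ⟨R, h, φ, a, b, c, d, ha.symm, hb.symm, hc.symm, hd.symm,
    fun x y => (map_sub φ x y).symm⟩

section VectorField

variable (X Y : Vect n) (P : S n)

/-- On vector fields `½ D_{(x,η)}² + ½ D_{(x,ξ)} D_{(x,η)}` is the coboundary of `½ Div`, and
`D_{(x,ξ)} D_{(x,η)}` is minus the Poisson bracket with the divergence. -/
lemma onDiag_C₁_eq (k : ℕ) : onDiag (C₁ n k) (symb X) P =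
    (1 / 2 : ℝ) • (lieS X (divS n P) - divS n (lieS X P)) +
      (1 / 2 + ((k : ℝ) - 1) / ((n : ℝ) + 1)) • onDiag (poissonOp n) (divS n (symb X)) P := by
  have h1 : poissonOp n * Dyeta n - (Dxxi n + Dxeta n + Dyxi n + Dyeta n) * poissonOp n =
      Dxxi n * Dxeta n + Dxeta n ^ 2 - Dyxi n * Dxxi n - Dyxi n * Dyxi n := by
    obtain ⟨R, _, φ, a, b, c, d, ha, hb, hc, hd, hsub⟩ := exists_commRing_bidiff n
    simp only [poissonOp, ha, hb, hc, hd, ← map_mul, ← map_add, ← map_pow, hsub]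
    exact congrArg φ (by ring)
  have h2 : poissonOp n * Dxxi n = Dyxi n * Dxxi n - Dxxi n * Dxeta n := by
    rw [poissonOp, sub_mul (α := Module.End ℝ (S n ⊗[ℝ] S n)), commute_Dxeta_Dxxi.eq]
  have e1 := congrArg (fun T => onDiag T (symb X) P) h1
  have e2 := congrArg (fun T => onDiag T (symb X) P) h2
  have z1 : onDiag (Dyxi n * Dxxi n) (symb X) P = 0 := by
    rw [onDiag, Dyxi_Dxxi_symb, map_zero]
  have z2 : onDiag (Dyxi n * Dyxi n) (symb X) P = 0 := by
    rw [onDiag, Dyxi_sq_symb, map_zero]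
  simp only [onDiag_sub, onDiag_add, z1, z2, sub_zero] at e1 e2
  rw [lieS_eq_onDiag, lieS_eq_onDiag, onDiag_divS_right, divS_onDiag, onDiag_divS_left, e1, e2,
    C₁, onDiag_sub, onDiag_smul, onDiag_smul]
  module

/-- On vector fields the operator `C₂` is the coboundary of `½ Div²` plus a multiple of the cube
of the Poisson operator. -/
lemma onDiag_C₂_eq (k : ℕ) : onDiag (C₂ n k) (symb X) P =
    (1 / 2 : ℝ) • (lieS X (divS n (divS n P)) - divS n (divS n (lieS X P))) -
      ((2 * (k : ℝ) + (n : ℝ) - 2) / 6) • onDiag (poissonOp n ^ 3) (symb X) P := by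
  -- The last three terms are left multiples of operators annihilating `symb X ⊗ P`.
  have h1 : poissonOp n * Dyeta n * Dyeta n - (Dxxi n + Dxeta n + Dyxi n + Dyeta n) *
      ((Dxxi n + Dxeta n + Dyxi n + Dyeta n) * poissonOp n) =
      2 * (Dxxi n * Dxeta n ^ 2) + Dxeta n ^ 3 + Dyxi n * Dxeta n ^ 2
      + 2 * (Dxxi n * Dxeta n * Dyeta n) + 2 * (Dxeta n ^ 2 * Dyeta n)
      + Dxeta n * (Dxxi n * Dxxi n)
      + (Dxeta n - (Dxxi n + Dxeta n + Dyxi n + 2 * Dyeta n)) * (Dyxi n * Dxxi n)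
      - (Dxxi n + Dxeta n + Dyxi n + 2 * Dyeta n) * (Dyxi n * Dyxi n) := by
    obtain ⟨R, _, φ, a, b, c, d, ha, hb, hc, hd, hsub⟩ := exists_commRing_bidiff n
    simp only [poissonOp, ha, hb, hc, hd, ← map_mul, ← map_add, ← map_pow, hsub, two_mul]
    exact congrArg φ (by ring)
  have h2 : poissonOp n ^ 3 = (Dyxi n * Dxeta n ^ 2 + Dyxi n * Dxeta n ^ 2 + Dyxi n * Dxeta n ^ 2)
      - Dxeta n ^ 3 + (Dyxi n - (Dxeta n + Dxeta n + Dxeta n)) * (Dyxi n * Dyxi n) := by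
    obtain ⟨R, _, φ, a, b, c, d, ha, hb, hc, hd, hsub⟩ := exists_commRing_bidiff n
    simp only [poissonOp, hb, hc, ← map_mul, ← map_add, ← map_pow, hsub]
    exact congrArg φ (by ring)
  have e1 := congrArg (fun T => onDiag T (symb X) P) h1
  have e2 := congrArg (fun T => onDiag T (symb X) P) h2
  simp only [onDiag_sub, onDiag_add, two_mul, sub_zero, add_zero,
    onDiag_mul_of_apply_eq_zero (Dyxi_Dxxi_symb X P),
    onDiag_mul_of_apply_eq_zero (Dyxi_sq_symb X P),
    onDiag_mul_of_apply_eq_zero (Dxxi_sq_symb X P)] at e1 e2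
  rw [lieS_eq_onDiag, lieS_eq_onDiag, onDiag_divS_right, onDiag_divS_right, divS_onDiag,
    divS_onDiag, e1, e2, C₂]
  simp only [onDiag_add, onDiag_smul]
  module

/-- The divergence is a 1-cocycle on vector fields with values in functions. -/
lemma divS_lieS_symb : divS n (lieS X (symb Y)) =
    lieS X (divS n (symb Y)) + onDiag (poissonOp n) (divS n (symb X)) (symb Y) := by
  have h : (Dxxi n + Dxeta n + Dyxi n + Dyeta n) * poissonOp n =
      poissonOp n * Dyeta n + poissonOp n * Dxxi n + Dyxi n * Dyxi n - Dxeta n * Dxeta n := by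
    obtain ⟨R, _, φ, a, b, c, d, ha, hb, hc, hd, hsub⟩ := exists_commRing_bidiff n
    simp only [poissonOp, ha, hb, hc, hd, ← map_mul, ← map_add, hsub]
    exact congrArg φ (by ring)
  have z1 : onDiag (Dyxi n * Dyxi n) (symb X) (symb Y) = 0 := by
    rw [onDiag, Dyxi_sq_symb, map_zero]
  have z2 : onDiag (Dxeta n * Dxeta n) (symb X) (symb Y) = 0 := by
    rw [onDiag, Dxeta_sq_symb, map_zero]
  rw [lieS_eq_onDiag, lieS_eq_onDiag, divS_onDiag, onDiag_divS_right, onDiag_divS_left, h]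
  simp only [onDiag_sub, onDiag_add, z1, z2, sub_zero, add_zero]

/-- The third order bracket of two vector fields vanishes, as it takes three derivatives along
the fibre. -/
lemma onDiag_poissonOp_cube_symb : onDiag (poissonOp n ^ 3) (symb X) (symb Y) = 0 := by
  have h : poissonOp n ^ 3 =
      (Dyxi n - (Dxeta n + Dxeta n + Dxeta n)) * (Dyxi n * Dyxi n) +
      (Dyxi n + Dyxi n + Dyxi n - Dxeta n) * (Dxeta n * Dxeta n) := by
    obtain ⟨R, _, φ, a, b, c, d, ha, hb, hc, hd, hsub⟩ := exists_commRing_bidiff n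
    simp only [poissonOp, hb, hc, ← map_mul, ← map_add, ← map_pow, hsub]
    exact congrArg φ (by ring)
  rw [h, onDiag_add, onDiag_mul_of_apply_eq_zero (Dyxi_sq_symb X _),
    onDiag_mul_of_apply_eq_zero (Dxeta_sq_symb Y _), add_zero]

end VectorField

/-! ### Composition of brackets -/

/-- The Poisson operator on the first two factors of `𝒮 ⊗ (𝒮 ⊗ 𝒮)`. -/
noncomputable def poisson₁₂ (n : ℕ) : Module.End ℝ (S n ⊗[ℝ] (S n ⊗[ℝ] S n)) :=
  ∑ i, TensorProduct.map (dxi i) (TensorProduct.map (dx i) LinearMap.id) -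
    ∑ i, TensorProduct.map (dx i) (TensorProduct.map (dxi i) LinearMap.id)

/-- The Poisson operator on the first and third factors of `𝒮 ⊗ (𝒮 ⊗ 𝒮)`. -/
noncomputable def poisson₁₃ (n : ℕ) : Module.End ℝ (S n ⊗[ℝ] (S n ⊗[ℝ] S n)) :=
  ∑ i, TensorProduct.map (dxi i) (TensorProduct.map LinearMap.id (dx i)) -
    ∑ i, TensorProduct.map (dx i) (TensorProduct.map LinearMap.id (dxi i))

/-- The Poisson operator on the last two factors of `𝒮 ⊗ (𝒮 ⊗ 𝒮)`. -/
noncomputable def poisson₂₃ (n : ℕ) : Module.End ℝ (S n ⊗[ℝ] (S n ⊗[ℝ] S n)) :=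
  ∑ i, TensorProduct.map LinearMap.id (TensorProduct.map (dxi i) (dx i)) -
    ∑ i, TensorProduct.map LinearMap.id (TensorProduct.map (dx i) (dxi i))

lemma poissonOp_tmul (F G : S n) : poissonOp n (F ⊗ₜ G) =
    ∑ i, (dxi i F ⊗ₜ dx i G - dx i F ⊗ₜ dxi i G) := by
  simp [poissonOp, Dyxi, Dxeta, LinearMap.sum_apply]

lemma poisson₁₂_tmul (F G H : S n) : poisson₁₂ n (F ⊗ₜ (G ⊗ₜ H)) =
    ∑ i, (dxi i F ⊗ₜ (dx i G ⊗ₜ H) - dx i F ⊗ₜ (dxi i G ⊗ₜ H)) := by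
  simp [poisson₁₂, LinearMap.sum_apply]

lemma poisson₁₃_tmul (F G H : S n) : poisson₁₃ n (F ⊗ₜ (G ⊗ₜ H)) =
    ∑ i, (dxi i F ⊗ₜ (G ⊗ₜ dx i H) - dx i F ⊗ₜ (G ⊗ₜ dxi i H)) := by
  simp [poisson₁₃, LinearMap.sum_apply]

lemma poisson₂₃_tmul (F G H : S n) : poisson₂₃ n (F ⊗ₜ (G ⊗ₜ H)) =
    ∑ i, (F ⊗ₜ (dxi i G ⊗ₜ dx i H) - F ⊗ₜ (dx i G ⊗ₜ dxi i H)) := by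
  simp [poisson₂₃, LinearMap.sum_apply]

/-- Multiplication of the last two factors. -/
noncomputable def mul₂₃ (n : ℕ) : S n ⊗[ℝ] (S n ⊗[ℝ] S n) →ₗ[ℝ] S n ⊗[ℝ] S n :=
  TensorProduct.map LinearMap.id (LinearMap.mul' ℝ (S n))

/-- Multiplication of the first and third factors; the second factor is moved to the front. -/
noncomputable def mul₁₃ (n : ℕ) : S n ⊗[ℝ] (S n ⊗[ℝ] S n) →ₗ[ℝ] S n ⊗[ℝ] S n :=
  mul₂₃ n ∘ₗ (TensorProduct.leftComm ℝ (S n) (S n) (S n)).toLinearMap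

/-- Multiplication of the first two factors. -/
noncomputable def mul₁₂ (n : ℕ) : S n ⊗[ℝ] (S n ⊗[ℝ] S n) →ₗ[ℝ] S n ⊗[ℝ] S n :=
  TensorProduct.map (LinearMap.mul' ℝ (S n)) LinearMap.id ∘ₗ
    (TensorProduct.assoc ℝ (S n) (S n) (S n)).symm.toLinearMap

lemma mul₂₃_tmul (F G H : S n) : mul₂₃ n (F ⊗ₜ (G ⊗ₜ H)) = F ⊗ₜ (G * H) := rfl

lemma mul₁₃_tmul (F G H : S n) : mul₁₃ n (F ⊗ₜ (G ⊗ₜ H)) = G ⊗ₜ (F * H) := rfl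

lemma mul₁₂_tmul (F G H : S n) : mul₁₂ n (F ⊗ₜ (G ⊗ₜ H)) = (F * G) ⊗ₜ H := rfl

lemma ext_tmul₃ {M : Type*} [AddCommGroup M] [Module ℝ M]
    {f g : S n ⊗[ℝ] (S n ⊗[ℝ] S n) →ₗ[ℝ] M}
    (h : ∀ F G H, f (F ⊗ₜ (G ⊗ₜ H)) = g (F ⊗ₜ (G ⊗ₜ H))) : f = g := by
  apply TensorProduct.ext'
  intro F t
  induction t using TensorProduct.induction_on with
  | zero => simp
  | tmul G H => exact h F G H
  | add t t' ht ht' => rw [TensorProduct.tmul_add, map_add, map_add, ht, ht']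

/-- The Leibniz rule: the bracket of `F` with a product `G H`. -/
lemma poissonOp_comp_mul₂₃ : poissonOp n ∘ₗ mul₂₃ n = mul₂₃ n ∘ₗ (poisson₁₂ n + poisson₁₃ n) := by
  apply ext_tmul₃
  intro F G H
  simp only [LinearMap.comp_apply, LinearMap.add_apply, mul₂₃_tmul, poissonOp_tmul,
    poisson₁₂_tmul, poisson₁₃_tmul, map_add, map_sum, map_sub, ← Finset.sum_add_distrib]
  refine Finset.sum_congr rfl fun i _ => ?_
  rw [dx_mul, dxi_mul, TensorProduct.tmul_add, TensorProduct.tmul_add]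
  abel

/-- The Leibniz rule for the bracket of `G` with `F H`; the sign comes from the antisymmetry of the
Poisson operator, as `G` is the second factor. -/
lemma poissonOp_comp_mul₁₃ : poissonOp n ∘ₗ mul₁₃ n = mul₁₃ n ∘ₗ (poisson₂₃ n - poisson₁₂ n) := by
  apply ext_tmul₃
  intro F G H
  simp only [LinearMap.comp_apply, LinearMap.sub_apply, mul₁₃_tmul, poissonOp_tmul,
    poisson₁₂_tmul, poisson₂₃_tmul, map_sum, map_sub, ← Finset.sum_sub_distrib]
  refine Finset.sum_congr rfl fun i _ => ?_
  rw [dx_mul, dxi_mul, TensorProduct.tmul_add, TensorProduct.tmul_add]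
  abel

lemma poissonOp_comp_mul₁₂ : poissonOp n ∘ₗ mul₁₂ n = mul₁₂ n ∘ₗ (poisson₁₃ n + poisson₂₃ n) := by
  apply ext_tmul₃
  intro F G H
  simp only [LinearMap.comp_apply, LinearMap.add_apply, mul₁₂_tmul, poissonOp_tmul,
    poisson₁₃_tmul, poisson₂₃_tmul, map_add, map_sum, map_sub, ← Finset.sum_add_distrib]
  refine Finset.sum_congr rfl fun i _ => ?_
  rw [dx_mul, dxi_mul, TensorProduct.add_tmul, TensorProduct.add_tmul]
  abel

/-- An intertwining relation passes to powers. -/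
lemma pow_comp_of_comp {M N : Type*} [AddCommGroup M] [AddCommGroup N] [Module ℝ M] [Module ℝ N]
    {f : M →ₗ[ℝ] N} {p : Module.End ℝ N} {q : Module.End ℝ M} (h : p ∘ₗ f = f ∘ₗ q) (r : ℕ)
    (t : M) : (p ^ r) (f t) = f ((q ^ r) t) := by
  induction r with
  | zero => rfl
  | succ r ih =>
    rw [pow_succ', pow_succ', Module.End.mul_apply, Module.End.mul_apply, ih]
    exact LinearMap.congr_fun h _

lemma commute_map {M N : Type*} [AddCommGroup M] [AddCommGroup N] [Module ℝ M] [Module ℝ N]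
    {u u' : Module.End ℝ M} {v v' : Module.End ℝ N} (hu : Commute u u') (hv : Commute v v') :
    Commute (S := Module.End ℝ (M ⊗[ℝ] N)) (TensorProduct.map u v) (TensorProduct.map u' v') := by
  change _ * _ = _ * _
  rw [← TensorProduct.map_mul, ← TensorProduct.map_mul, hu.eq, hv.eq]

lemma commute_sub_sub {A : Type*} [Ring A] {a b c d : A} (hac : Commute a c) (had : Commute a d)
    (hbc : Commute b c) (hbd : Commute b d) : Commute (a - b) (c - d) :=
  (hac.sub_right had).sub_left (hbc.sub_right hbd)

lemma commute_poisson₁₂_poisson₁₃ : Commute (poisson₁₂ n) (poisson₁₃ n) := by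
  refine commute_sub_sub (A := Module.End ℝ (S n ⊗[ℝ] (S n ⊗[ℝ] S n))) ?_ ?_ ?_ ?_
  · exact commute_sum_map commute_dxi_dxi fun _ _ =>
      commute_map (commute_end_id _) (commute_id_end _)
  · exact commute_sum_map commute_dxi_dx fun _ _ =>
      commute_map (commute_end_id _) (commute_id_end _)
  · exact commute_sum_map commute_dx_dxi fun _ _ =>
      commute_map (commute_end_id _) (commute_id_end _)
  · exact commute_sum_map commute_dx_dx fun _ _ =>
      commute_map (commute_end_id _) (commute_id_end _)

lemma commute_poisson₁₂_poisson₂₃ : Commute (poisson₁₂ n) (poisson₂₃ n) := by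
  refine commute_sub_sub (A := Module.End ℝ (S n ⊗[ℝ] (S n ⊗[ℝ] S n))) ?_ ?_ ?_ ?_
  · exact commute_sum_map (fun _ _ => commute_end_id _) fun i j =>
      commute_map (commute_dx_dxi i j) (commute_id_end _)
  · exact commute_sum_map (fun _ _ => commute_end_id _) fun i j =>
      commute_map (commute_dx_dx i j) (commute_id_end _)
  · exact commute_sum_map (fun _ _ => commute_end_id _) fun i j =>
      commute_map (commute_dxi_dxi i j) (commute_id_end _)
  · exact commute_sum_map (fun _ _ => commute_end_id _) fun i j =>
      commute_map (commute_dxi_dx i j) (commute_id_end _)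

lemma commute_poisson₁₃_poisson₂₃ : Commute (poisson₁₃ n) (poisson₂₃ n) := by
  refine commute_sub_sub (A := Module.End ℝ (S n ⊗[ℝ] (S n ⊗[ℝ] S n))) ?_ ?_ ?_ ?_
  · exact commute_sum_map (fun _ _ => commute_end_id _) fun i j =>
      commute_map (commute_id_end _) (commute_dx_dx i j)
  · exact commute_sum_map (fun _ _ => commute_end_id _) fun i j =>
      commute_map (commute_id_end _) (commute_dx_dxi i j)
  · exact commute_sum_map (fun _ _ => commute_end_id _) fun i j =>
      commute_map (commute_id_end _) (commute_dxi_dx i j)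
  · exact commute_sum_map (fun _ _ => commute_end_id _) fun i j =>
      commute_map (commute_id_end _) (commute_dxi_dxi i j)

/-- A commutative ring in which identities between the three Poisson operators can be checked. -/
lemma exists_commRing_poisson (n : ℕ) :
    ∃ (R : Type) (_ : CommRing R) (φ : R →+* Module.End ℝ (S n ⊗[ℝ] (S n ⊗[ℝ] S n)))
      (a b c : R), poisson₁₂ n = φ a ∧ poisson₁₃ n = φ b ∧ poisson₂₃ n = φ c ∧
      ∀ x y, φ x - φ y = φ (x - y) := by
  obtain ⟨R, h, φ, a, b, c, d, ha, hb, hc, -⟩ := exists_commRing_of_commute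
    (A := Module.End ℝ (S n ⊗[ℝ] (S n ⊗[ℝ] S n))) (commute_poisson₁₂_poisson₁₃ (n := n))
    commute_poisson₁₂_poisson₂₃ (Commute.refl _) commute_poisson₁₃_poisson₂₃
    commute_poisson₁₂_poisson₁₃.symm commute_poisson₁₂_poisson₂₃.symm
  exact ⟨R, h, φ, a, b, c, ha.symm, hb.symm, hc.symm, fun x y => (map_sub φ x y).symm⟩

/-- Multiplication of all three factors. -/
noncomputable def mul₁₂₃ (n : ℕ) : S n ⊗[ℝ] (S n ⊗[ℝ] S n) →ₗ[ℝ] S n :=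
  LinearMap.mul' ℝ (S n) ∘ₗ mul₂₃ n

lemma mul'_mul₁₃ (t : S n ⊗[ℝ] (S n ⊗[ℝ] S n)) :
    LinearMap.mul' ℝ (S n) (mul₁₃ n t) = mul₁₂₃ n t := by
  have : LinearMap.mul' ℝ (S n) ∘ₗ mul₁₃ n = mul₁₂₃ n :=
    ext_tmul₃ fun F G H => by
      simp only [mul₁₂₃, LinearMap.comp_apply, mul₁₃_tmul, mul₂₃_tmul, LinearMap.mul'_apply]
      ring
  exact LinearMap.congr_fun this t

lemma mul'_mul₁₂ (t : S n ⊗[ℝ] (S n ⊗[ℝ] S n)) :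
    LinearMap.mul' ℝ (S n) (mul₁₂ n t) = mul₁₂₃ n t := by
  have : LinearMap.mul' ℝ (S n) ∘ₗ mul₁₂ n = mul₁₂₃ n :=
    ext_tmul₃ fun F G H => by
      simp only [mul₁₂₃, LinearMap.comp_apply, mul₁₂_tmul, mul₂₃_tmul, LinearMap.mul'_apply]
      ring
  exact LinearMap.congr_fun this t

section Compose

variable (r s : ℕ) (F G H : S n)

/-- Nested brackets as operators on the triple tensor product. -/
lemma onDiag_pow_onDiag_pow_right :
    onDiag (poissonOp n ^ r) F (onDiag (poissonOp n ^ s) G H) =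
      mul₁₂₃ n (((poisson₁₂ n + poisson₁₃ n) ^ r * poisson₂₃ n ^ s) (F ⊗ₜ (G ⊗ₜ H))) := by
  have h : poisson₂₃ n ∘ₗ TensorProduct.mk ℝ (S n) (S n ⊗[ℝ] S n) F =
      TensorProduct.mk ℝ (S n) (S n ⊗[ℝ] S n) F ∘ₗ poissonOp n := by
    apply TensorProduct.ext'
    intro G H
    simp [poisson₂₃_tmul, poissonOp_tmul, TensorProduct.tmul_sum, TensorProduct.tmul_sub]
  have h' := pow_comp_of_comp h s (G ⊗ₜ H)
  simp only [TensorProduct.mk_apply] at h'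
  rw [Module.End.mul_apply, h', mul₁₂₃, LinearMap.comp_apply,
    ← pow_comp_of_comp poissonOp_comp_mul₂₃]
  rfl

lemma onDiag_pow_onDiag_pow_middle :
    onDiag (poissonOp n ^ r) G (onDiag (poissonOp n ^ s) F H) =
      mul₁₂₃ n (((poisson₂₃ n - poisson₁₂ n) ^ r * poisson₁₃ n ^ s) (F ⊗ₜ (G ⊗ₜ H))) := by
  let f : S n ⊗[ℝ] S n →ₗ[ℝ] S n ⊗[ℝ] (S n ⊗[ℝ] S n) :=
    (TensorProduct.leftComm ℝ (S n) (S n) (S n)).toLinearMap ∘ₗ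
      TensorProduct.mk ℝ (S n) (S n ⊗[ℝ] S n) G
  have hf : ∀ F H : S n, f (F ⊗ₜ H) = F ⊗ₜ (G ⊗ₜ H) := fun _ _ => rfl
  have h : poisson₁₃ n ∘ₗ f = f ∘ₗ poissonOp n := by
    apply TensorProduct.ext'
    intro F H
    simp only [LinearMap.comp_apply, hf, poisson₁₃_tmul, poissonOp_tmul, map_sum, map_sub]
  rw [Module.End.mul_apply, ← hf, pow_comp_of_comp h s, ← mul'_mul₁₃,
    ← pow_comp_of_comp poissonOp_comp_mul₁₃]
  have h2 : mul₁₃ n ∘ₗ f =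
      TensorProduct.mk ℝ (S n) (S n) G ∘ₗ LinearMap.mul' ℝ (S n) :=
    TensorProduct.ext' fun F H => by rw [LinearMap.comp_apply, hf]; rfl
  exact congrArg (fun w => LinearMap.mul' ℝ (S n) ((poissonOp n ^ r) w))
    (LinearMap.congr_fun h2 ((poissonOp n ^ s) (F ⊗ₜ H))).symm

lemma onDiag_pow_onDiag_pow_left :
    onDiag (poissonOp n ^ r) (onDiag (poissonOp n ^ s) F G) H =
      mul₁₂₃ n (((poisson₁₃ n + poisson₂₃ n) ^ r * poisson₁₂ n ^ s) (F ⊗ₜ (G ⊗ₜ H))) := by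
  let f : S n ⊗[ℝ] S n →ₗ[ℝ] S n ⊗[ℝ] (S n ⊗[ℝ] S n) :=
    (TensorProduct.assoc ℝ (S n) (S n) (S n)).toLinearMap ∘ₗ
      (TensorProduct.mk ℝ (S n ⊗[ℝ] S n) (S n)).flip H
  have hf : ∀ F G : S n, f (F ⊗ₜ G) = F ⊗ₜ (G ⊗ₜ H) := fun _ _ => rfl
  have h : poisson₁₂ n ∘ₗ f = f ∘ₗ poissonOp n := by
    apply TensorProduct.ext'
    intro F H
    simp only [LinearMap.comp_apply, hf, poisson₁₂_tmul, poissonOp_tmul, map_sum, map_sub]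
  rw [Module.End.mul_apply, ← hf, pow_comp_of_comp h s, ← mul'_mul₁₂,
    ← pow_comp_of_comp poissonOp_comp_mul₁₂]
  have h2 : mul₁₂ n ∘ₗ f =
      (TensorProduct.mk ℝ (S n) (S n)).flip H ∘ₗ LinearMap.mul' ℝ (S n) :=
    TensorProduct.ext' fun F G => by rw [LinearMap.comp_apply, hf]; rfl
  exact congrArg (fun w => LinearMap.mul' ℝ (S n) ((poissonOp n ^ r) w))
    (LinearMap.congr_fun h2 ((poissonOp n ^ s) (F ⊗ₜ G))).symm

end Compose

/-- The Jacobi identity of the Poisson bracket. -/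
lemma poisson_jacobi (F G H : S n) :
    onDiag (poissonOp n) (onDiag (poissonOp n) F G) H =
      onDiag (poissonOp n) F (onDiag (poissonOp n) G H) -
        onDiag (poissonOp n) G (onDiag (poissonOp n) F H) := by
  have h : (poisson₁₃ n + poisson₂₃ n) ^ 1 * poisson₁₂ n ^ 1 =
      (poisson₁₂ n + poisson₁₃ n) ^ 1 * poisson₂₃ n ^ 1 -
        (poisson₂₃ n - poisson₁₂ n) ^ 1 * poisson₁₃ n ^ 1 := by
    obtain ⟨R, _, φ, a, b, c, ha, hb, hc, hsub⟩ := exists_commRing_poisson n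
    simp only [ha, hb, hc, ← map_mul, ← map_add, ← map_pow, hsub]
    exact congrArg φ (by ring)
  have e1 := onDiag_pow_onDiag_pow_right 1 1 F G H
  have e2 := onDiag_pow_onDiag_pow_middle 1 1 F G H
  have e3 := onDiag_pow_onDiag_pow_left 1 1 F G H
  rw [h, LinearMap.sub_apply, map_sub, ← e1, ← e2] at e3
  simpa only [pow_one] using e3

/-- The third order bracket, given by the cube of the Poisson operator, is a 2-cocycle of the
Poisson bracket (the first correction to the Poisson bracket in the Moyal bracket). -/
lemma poisson_cube_cocycle (F G H : S n) :
    onDiag (poissonOp n ^ 3) (onDiag (poissonOp n) F G) H +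
      onDiag (poissonOp n) (onDiag (poissonOp n ^ 3) F G) H =
      onDiag (poissonOp n) F (onDiag (poissonOp n ^ 3) G H) -
        onDiag (poissonOp n) G (onDiag (poissonOp n ^ 3) F H) +
      (onDiag (poissonOp n ^ 3) F (onDiag (poissonOp n) G H) -
        onDiag (poissonOp n ^ 3) G (onDiag (poissonOp n) F H)) := by
  have h : (poisson₁₃ n + poisson₂₃ n) ^ 3 * poisson₁₂ n ^ 1 +
        (poisson₁₃ n + poisson₂₃ n) ^ 1 * poisson₁₂ n ^ 3 =
      (poisson₁₂ n + poisson₁₃ n) ^ 1 * poisson₂₃ n ^ 3 -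
        (poisson₂₃ n - poisson₁₂ n) ^ 1 * poisson₁₃ n ^ 3 +
      ((poisson₁₂ n + poisson₁₃ n) ^ 3 * poisson₂₃ n ^ 1 -
        (poisson₂₃ n - poisson₁₂ n) ^ 3 * poisson₁₃ n ^ 1) := by
    obtain ⟨R, _, φ, a, b, c, ha, hb, hc, hsub⟩ := exists_commRing_poisson n
    simp only [ha, hb, hc, ← map_mul, ← map_add, ← map_pow, hsub]
    exact congrArg φ (by ring)
  have e := congrArg (fun T => mul₁₂₃ n (T (F ⊗ₜ (G ⊗ₜ H)))) h
  simp only [LinearMap.add_apply, LinearMap.sub_apply, map_add, map_sub,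
    ← onDiag_pow_onDiag_pow_right, ← onDiag_pow_onDiag_pow_middle,
    ← onDiag_pow_onDiag_pow_left] at e
  simpa only [pow_one] using e

/-! ### The cocycle identities -/

section Cocycle

variable (X Y : Vect n) (P : S n)

/-- Vector fields act on `𝒮` as a Lie algebra. -/
lemma lieS_bracket : lieS ⁅X, Y⁆ P = lieS X (lieS Y P) - lieS Y (lieS X P) := by
  rw [lieS_eq_onDiag, symb_bracket]
  simp only [lieS_eq_onDiag]
  exact poisson_jacobi _ _ _

/-- The cocycle identity for `c₁`. -/
lemma onDiag_C₁_bracket (k : ℕ) : onDiag (C₁ n k) (symb ⁅X, Y⁆) P =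
    (lieS X (onDiag (C₁ n k) (symb Y) P) - onDiag (C₁ n k) (symb Y) (lieS X P)) -
      (lieS Y (onDiag (C₁ n k) (symb X) P) - onDiag (C₁ n k) (symb X) (lieS Y P)) := by
  have e : onDiag (poissonOp n) (divS n (symb ⁅X, Y⁆)) P =
      lieS X (onDiag (poissonOp n) (divS n (symb Y)) P) -
        onDiag (poissonOp n) (divS n (symb Y)) (lieS X P) -
      (lieS Y (onDiag (poissonOp n) (divS n (symb X)) P) -
        onDiag (poissonOp n) (divS n (symb X)) (lieS Y P)) := by
    rw [symb_bracket, divS_lieS_symb, onDiag_add_left]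
    simp only [lieS_eq_onDiag, poisson_jacobi]
    abel
  simp only [onDiag_C₁_eq, e, lieS_bracket, map_add, map_sub, map_smul]
  module

/-- The cocycle identity for `c₂`. -/
lemma onDiag_C₂_bracket (k : ℕ) : onDiag (C₂ n k) (symb ⁅X, Y⁆) P =
    (lieS X (onDiag (C₂ n k) (symb Y) P) - onDiag (C₂ n k) (symb Y) (lieS X P)) -
      (lieS Y (onDiag (C₂ n k) (symb X) P) - onDiag (C₂ n k) (symb X) (lieS Y P)) := by
  have e : onDiag (poissonOp n ^ 3) (symb ⁅X, Y⁆) P =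
      lieS X (onDiag (poissonOp n ^ 3) (symb Y) P) -
        onDiag (poissonOp n ^ 3) (symb Y) (lieS X P) -
      (lieS Y (onDiag (poissonOp n ^ 3) (symb X) P) -
        onDiag (poissonOp n ^ 3) (symb X) (lieS Y P)) := by
    have h := poisson_cube_cocycle (symb X) (symb Y) P
    rw [onDiag_poissonOp_cube_symb,
      show onDiag (poissonOp n) 0 P = 0 by simp [onDiag], add_zero] at h
    rw [symb_bracket]
    simp only [lieS_eq_onDiag, h]
    abel
  simp only [onDiag_C₂_eq, e, lieS_bracket, map_sub, map_smul]
  module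

end Cocycle

/-! ### Explicit formulas and differential operators -/

section Explicit

variable (F G : S n)

lemma Dxeta_tmul : Dxeta n (F ⊗ₜ G) = ∑ i, dx i F ⊗ₜ dxi i G := by
  simp [Dxeta, LinearMap.sum_apply]

lemma Dyxi_tmul : Dyxi n (F ⊗ₜ G) = ∑ i, dxi i F ⊗ₜ dx i G := by
  simp [Dyxi, LinearMap.sum_apply]

lemma onDiag_Dxeta_sq : onDiag (Dxeta n ^ 2) F G =
    ∑ b, ∑ a, dx a (dx b F) * dxi a (dxi b G) := by
  simp [onDiag, pow_succ, Dxeta_tmul, map_sum]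

lemma onDiag_Dxxi_Dxeta : onDiag (Dxxi n * Dxeta n) F G =
    ∑ b, divS n (dx b F) * dxi b G := by
  simp [onDiag, Dxeta_tmul, Dxxi_tmul, map_sum]

lemma onDiag_Dxeta_sq_Dyeta : onDiag (Dxeta n ^ 2 * Dyeta n) F G =
    ∑ b, ∑ a, dx a (dx b F) * dxi a (dxi b (divS n G)) := by
  rw [← onDiag_divS_right, onDiag_Dxeta_sq]

lemma onDiag_Dxeta_cube : onDiag (Dxeta n ^ 3) F G =
    ∑ c, ∑ b, ∑ a, dx a (dx b (dx c F)) * dxi a (dxi b (dxi c G)) := by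
  simp [onDiag, pow_succ, Dxeta_tmul, map_sum]

lemma onDiag_Dxxi_Dxeta_Dyeta : onDiag (Dxxi n * Dxeta n * Dyeta n) F G =
    ∑ b, divS n (dx b F) * dxi b (divS n G) := by
  rw [← onDiag_divS_right, onDiag_Dxxi_Dxeta]

lemma onDiag_Dxxi_Dxeta_sq : onDiag (Dxxi n * Dxeta n ^ 2) F G =
    ∑ b, ∑ a, divS n (dx a (dx b F)) * dxi a (dxi b G) := by
  simp [onDiag, pow_succ, Dxeta_tmul, Dxxi_tmul, map_sum]

lemma onDiag_Dyxi_Dxeta_sq : onDiag (Dyxi n * Dxeta n ^ 2) F G =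
    ∑ b, ∑ a, ∑ c, dxi c (dx a (dx b F)) * dx c (dxi a (dxi b G)) := by
  simp [onDiag, pow_succ, Dxeta_tmul, Dyxi_tmul, map_sum]

lemma onDiag_C₁_apply (k : ℕ) : onDiag (C₁ n k) F G =
    (1 / 2 : ℝ) • (∑ b, ∑ a, dx a (dx b F) * dxi a (dxi b G)) -
      (((k : ℝ) - 1) / ((n : ℝ) + 1)) • ∑ b, divS n (dx b F) * dxi b G := by
  rw [C₁, onDiag_sub, onDiag_smul, onDiag_smul, onDiag_Dxeta_sq, onDiag_Dxxi_Dxeta]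

lemma onDiag_C₂_apply (k : ℕ) : onDiag (C₂ n k) F G =
    (2 / 2 : ℝ) • (∑ b, ∑ a, dx a (dx b F) * dxi a (dxi b (divS n G))) +
    ((2 * (k : ℝ) + (n : ℝ) + 1) / 6) •
      (∑ c, ∑ b, ∑ a, dx a (dx b (dx c F)) * dxi a (dxi b (dxi c G))) +
    (1 : ℝ) • (∑ b, divS n (dx b F) * dxi b (divS n G)) +
    (2 / 2 : ℝ) • (∑ b, ∑ a, divS n (dx a (dx b F)) * dxi a (dxi b G)) +
    (-(2 * (k : ℝ) + (n : ℝ) - 3) / 2) •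
      ∑ b, ∑ a, ∑ c, dxi c (dx a (dx b F)) * dx c (dxi a (dxi b G)) := by
  simp only [C₂, onDiag_add, onDiag_smul, onDiag_Dxeta_sq_Dyeta, onDiag_Dxeta_cube,
    onDiag_Dxxi_Dxeta_Dyeta, onDiag_Dxxi_Dxeta_sq, onDiag_Dyxi_Dxeta_sq]

end Explicit

lemma divS_apply (P : S n) : divS n P = ∑ i, dx i (dxi i P) := by
  simp [divS]

/-- The iterated fibre derivative `∂_{ξ_{i₁}} ⋯ ∂_{ξ_{i_r}}`, linear over `C^∞(ℝⁿ)`. -/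
noncomputable def dxiList (J : List (Fin n)) : S n →ₗ[Smooth n] S n :=
  (J.map fun i => ((MvPolynomial.pderiv i).toLinearMap : Module.End (Smooth n) (S n))).prod

lemma dxiList_cons (i : Fin n) (J : List (Fin n)) (P : S n) :
    dxiList (i :: J) P = dxi i (dxiList J P) := by
  rw [dxiList, List.map_cons, List.prod_cons]
  rfl

lemma dxi_eq_zero {i : Fin n} {P : S n} (hP : P.IsHomogeneous 0) : dxi i P = 0 := by
  rw [MvPolynomial.totalDegree_eq_zero_iff_eq_C.1 (Nat.le_zero.1 hP.totalDegree_le)]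
  exact dxi_C _ _

lemma dxiList_isHomogeneous {k : ℕ} (J : List (Fin n)) {P : S n} (hP : P.IsHomogeneous k) :
    (dxiList J P).IsHomogeneous (k - J.length) := by
  induction J with
  | nil => exact hP
  | cons i J ih =>
    rw [dxiList_cons, List.length_cons, ← Nat.sub_sub]
    exact dxi_isHomogeneous i ih

lemma dxiList_eq_zero {k : ℕ} {J : List (Fin n)} (hJ : k < J.length) {P : S n}
    (hP : P.IsHomogeneous k) : dxiList J P = 0 := by
  cases J with
  | nil => simp at hJ
  | cons i J =>
    rw [dxiList_cons]
    have h := dxiList_isHomogeneous J hP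
    rw [Nat.sub_eq_zero_of_le (by simpa [Nat.lt_succ_iff] using hJ)] at h
    exact dxi_eq_zero h

/-- No truncated subtraction occurs in the degree: if `J` is longer than `k`, then the product is
zero, hence homogeneous of every degree. -/
lemma mul_dxiList_isHomogeneous {d k l : ℕ} {J : List (Fin n)} (h : d + k = l + J.length)
    {F P : S n} (hF : F.IsHomogeneous d) (hP : P.IsHomogeneous k) :
    (F * dxiList J P).IsHomogeneous l := by
  rcases lt_or_ge k J.length with hJ | hJ
  · rw [dxiList_eq_zero hJ hP, mul_zero]
    exact MvPolynomial.isHomogeneous_zero _ _ _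
  · have h' := hF.mul (dxiList_isHomogeneous J hP)
    rwa [show d + (k - J.length) = l by omega] at h'

lemma coe_prod_dxk {k : ℕ} (I : List (Fin n)) (P : Sk n k) :
    (((I.map (dxk k)).prod P : Sk n k) : S n) = I.foldr (fun i Q => dx i Q) P.1 := by
  induction I with
  | nil => rfl
  | cons i I ih =>
    rw [List.map_cons, List.prod_cons, List.foldr_cons, ← ih]
    rfl

/-- The map `f` on the space `𝒮` of all tensor fields restricts to a differential operator
from `𝒮_k` to `𝒮_l`. -/
def RestrictsToDiffOp (k l : ℕ) (f : S n → S n) : Prop :=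
  ∃ T ∈ DiffOp n k l, ∀ P : Sk n k, (T P : S n) = f P

namespace RestrictsToDiffOp

variable {k l : ℕ} {f g : S n → S n}

lemma congr (hf : RestrictsToDiffOp k l f) (h : ∀ P, f P = g P) : RestrictsToDiffOp k l g := by
  obtain ⟨T, hT, hTf⟩ := hf
  exact ⟨T, hT, fun P => (hTf P).trans (h P)⟩

lemma add (hf : RestrictsToDiffOp k l f) (hg : RestrictsToDiffOp k l g) :
    RestrictsToDiffOp k l fun P => f P + g P := by
  obtain ⟨T, hT, hTf⟩ := hf
  obtain ⟨U, hU, hUg⟩ := hg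
  exact ⟨T + U, add_mem hT hU, fun P => congrArg₂ (· + ·) (hTf P) (hUg P)⟩

lemma smul (c : ℝ) (hf : RestrictsToDiffOp k l f) : RestrictsToDiffOp k l fun P => c • f P := by
  obtain ⟨T, hT, hTf⟩ := hf
  exact ⟨c • T, Submodule.smul_mem _ c hT, fun P => congrArg (c • ·) (hTf P)⟩

lemma sub (hf : RestrictsToDiffOp k l f) (hg : RestrictsToDiffOp k l g) :
    RestrictsToDiffOp k l fun P => f P - g P :=
  (hf.add (hg.smul (-1))).congr fun P => by rw [neg_one_smul, sub_eq_add_neg]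

lemma sum {ι : Type*} {s : Finset ι} {f : ι → S n → S n}
    (hf : ∀ i, RestrictsToDiffOp k l (f i)) :
    RestrictsToDiffOp k l fun P => ∑ i ∈ s, f i P := by
  classical
  induction s using Finset.induction_on with
  | empty => exact ⟨0, zero_mem _, fun P => rfl⟩
  | insert i s hi ih =>
    exact ((hf i).add ih).congr fun P => (Finset.sum_insert hi).symm

/-- The generating differential operators: multiplication by `F` after constant coefficient
derivatives. -/
lemma basic {d : ℕ} {F : S n} (hF : F.IsHomogeneous d) (J I : List (Fin n))
    (h : d + k = l + J.length) :
    RestrictsToDiffOp k l fun P => F * dxiList J (I.foldr (fun i Q => dx i Q) P) := by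
  let b : Sk n k →ₗ[Smooth n] Sk n l :=
    { toFun := fun P => ⟨F * dxiList J P.1, mul_dxiList_isHomogeneous h hF P.2⟩
      map_add' := fun P Q => Subtype.ext <| by
        change F * dxiList J (P.1 + Q.1) = F * dxiList J P.1 + F * dxiList J Q.1
        rw [map_add, mul_add]
      map_smul' := fun c P => Subtype.ext <| by
        change F * dxiList J (c • P.1) = c • (F * dxiList J P.1)
        rw [map_smul, mul_smul_comm] }
  refine ⟨_, Submodule.subset_span ⟨b, I, rfl⟩, fun P => ?_⟩
  change F * dxiList J ((I.map (dxk k)).prod P : Sk n k).1 = _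
  rw [coe_prod_dxk]

end RestrictsToDiffOp

lemma divS_isHomogeneous {k : ℕ} {P : S n} (hP : P.IsHomogeneous k) :
    (divS n P).IsHomogeneous (k - 1) := by
  rw [divS_apply]
  exact MvPolynomial.IsHomogeneous.sum _ _ _ fun i _ =>
    dx_isHomogeneous i (dxi_isHomogeneous i hP)

lemma dxi_divS (i : Fin n) (P : S n) : dxi i (divS n P) = ∑ c, dxi i (dxi c (dx c P)) := by
  simp only [divS_apply, map_sum, dx_dxi_comm]

open RestrictsToDiffOp in
lemma restrictsToDiffOp_C₁ {k l : ℕ} (h : k = l + 1) (X : Vect n) :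
    RestrictsToDiffOp k l (onDiag (C₁ n k) (symb X)) := by
  have h2 (a b : Fin n) := dx_isHomogeneous a (dx_isHomogeneous b (symb_isHomogeneous X))
  have h1 (b : Fin n) := divS_isHomogeneous (dx_isHomogeneous b (symb_isHomogeneous X))
  refine RestrictsToDiffOp.congr ?_ fun P => (onDiag_C₁_apply (symb X) P k).symm
  refine .sub (.smul _ (sum fun b => sum fun a => ?_)) (.smul _ (sum fun b => ?_))
  · exact basic (h2 a b) [a, b] [] (by simp; omega)
  · exact basic (h1 b) [b] [] (by simp; omega)

open RestrictsToDiffOp in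
lemma restrictsToDiffOp_C₂ {k l : ℕ} (h : k = l + 2) (X : Vect n) :
    RestrictsToDiffOp k l (onDiag (C₂ n k) (symb X)) := by
  have h1 (b : Fin n) := dx_isHomogeneous b (symb_isHomogeneous X)
  have h2 (a b : Fin n) := dx_isHomogeneous a (h1 b)
  have h3 (a b c : Fin n) := dx_isHomogeneous a (h2 b c)
  refine RestrictsToDiffOp.congr ?_ fun P => (onDiag_C₂_apply (symb X) P k).symm
  simp only [dxi_divS, map_sum, dx_dxi_comm, Finset.mul_sum]
  refine .add (.add (.add (.add (.smul _ (sum fun b => sum fun a => sum fun c => ?_))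
    (.smul _ (sum fun c => sum fun b => sum fun a => ?_)))
    (.smul _ (sum fun b => sum fun c => ?_)))
    (.smul _ (sum fun b => sum fun a => ?_)))
    (.smul _ (sum fun b => sum fun a => sum fun c => ?_))
  · exact basic (h2 a b) [a, b, c] [c] (by simp; omega)
  · exact basic (h3 a b c) [a, b, c] [] (by simp; omega)
  · exact basic (divS_isHomogeneous (h1 b)) [b, c] [c] (by simp; omega)
  · exact basic (divS_isHomogeneous (h2 a b)) [a, b] [] (by simp; omega)
  · exact basic (dxi_isHomogeneous c (h2 a b)) [a, b] [c] (by simp; omega)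

/-! ### The projective Lie algebra -/

/-- The coordinate function `x^i`. -/
noncomputable def coord (i : Fin n) : Smooth n :=
  ⟨fun x => x i, show ContDiff ℝ ∞ (EuclideanSpace.proj (𝕜 := ℝ) i) from
    (EuclideanSpace.proj (𝕜 := ℝ) i).contDiff⟩

lemma pd_coord (i j : Fin n) : pd i (coord j) = if i = j then 1 else 0 := by
  apply Smooth.ext
  intro x
  change fderiv ℝ (EuclideanSpace.proj (𝕜 := ℝ) j) x (EuclideanSpace.single i 1) = _
  rw [ContinuousLinearMap.fderiv]
  rcases eq_or_ne i j with rfl | h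
  · rw [if_pos rfl]
    exact (PiLp.single_apply 2 ℝ i 1 i).trans (if_pos rfl)
  · rw [if_neg h]
    exact (PiLp.single_apply 2 ℝ i 1 j).trans (if_neg h.symm)

/-- The vector field `f ∂/∂x^j`. -/
noncomputable def field (f : Smooth n) (j : Fin n) : Vect n :=
  ⟨fun x => f.1 x • EuclideanSpace.single j 1, f.contDiff.smul contDiff_const⟩

lemma comp_field (f : Smooth n) (i j : Fin n) :
    comp (field f j) i = if i = j then f else 0 := by
  apply Smooth.ext
  intro x
  change (f.1 x • EuclideanSpace.single j (1 : ℝ)) i = _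
  rw [PiLp.smul_apply, PiLp.single_apply]
  split_ifs
  · simp
  · simp only [smul_zero]
    rfl

lemma symb_field (f : Smooth n) (j : Fin n) :
    symb (field f j) = MvPolynomial.C f * MvPolynomial.X j := by
  simp [symb, comp_field, apply_ite MvPolynomial.C, ite_mul]

lemma field_one_mem_slAlg (i : Fin n) : field 1 i ∈ slAlg n :=
  Submodule.subset_span (.inl ⟨i, fun _ => one_smul ℝ _⟩)

lemma field_coord_mem_slAlg (i j : Fin n) : field (coord i) j ∈ slAlg n :=
  Submodule.subset_span (.inr (.inl ⟨i, j, fun _ => rfl⟩))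

lemma dx_dx_symb (a b : Fin n) (X : Vect n) : dx a (dx b (symb X)) =
    ∑ j, MvPolynomial.C (pd a (pd b (comp X j))) * MvPolynomial.X j := by
  simp [dx_symb, map_sum, dx_C_mul_X]

lemma pd_ite_one (a : Fin n) (p : Prop) [Decidable p] :
    pd a (if p then (1 : Smooth n) else 0) = 0 := by
  split_ifs <;> simp [pd_one]

/-- Induction over `sl(n+1, ℝ)` through the second derivatives of the spanning fields: they vanish
for the affine fields and are those of `x^i x^j ξ_j` for the quadratic ones. -/
lemma induction_slAlg {p : Vect n → Prop} (h0 : p 0) (hadd : ∀ X Y, p X → p Y → p (X + Y))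
    (hsmul : ∀ (c : ℝ) X, p X → p (c • X))
    (haff : ∀ X, (∀ a b, dx a (dx b (symb X)) = 0) → p X)
    (hquad : ∀ X i, (∀ a b, dx a (dx b (symb X)) =
      (if b = i then MvPolynomial.X a else 0) + (if a = i then MvPolynomial.X b else 0)) → p X)
    {X : Vect n} (hX : X ∈ slAlg n) : p X := by
  induction hX using Submodule.span_induction with
  | zero => exact h0
  | add X Y _ _ hX hY => exact hadd X Y hX hY
  | smul c X _ hX => exact hsmul c X hX
  | mem X hX =>
    rcases hX with ⟨i, hi⟩ | ⟨i, j, hij⟩ | ⟨i, hi⟩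
    · obtain rfl : X = field 1 i := Subtype.ext (funext fun x => (hi x).trans (one_smul ℝ _).symm)
      refine haff _ fun a b => ?_
      rw [symb_field, dx_C_mul_X, pd_one]
      simp
    · obtain rfl : X = field (coord i) j := Subtype.ext (funext fun x => hij x)
      refine haff _ fun a b => ?_
      rw [symb_field, dx_C_mul_X, dx_C_mul_X, pd_coord, pd_ite_one]
      simp
    · have hc : ∀ j, comp X j = coord i * coord j := by
        intro j
        apply Smooth.ext
        intro x
        change X.1 x j = x i * x j
        rw [hi x]
        rfl
      refine hquad X i fun a b => ?_
      simp only [dx_dx_symb, hc, pd_mul, pd_coord, map_add, pd_ite_one, zero_mul, mul_zero,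
        zero_add, add_zero, add_mul, Finset.sum_add_distrib]
      congr 1 <;> split_ifs with h <;> simp

section Quadratic

variable {X : Vect n} {i : Fin n}

lemma divS_dx_symb_quadratic (hX : ∀ a b, dx a (dx b (symb X)) =
    (if b = i then MvPolynomial.X a else 0) + (if a = i then MvPolynomial.X b else 0))
    (b : Fin n) :
    divS n (dx b (symb X)) = if b = i then ((n : ℝ) + 1) • (1 : S n) else 0 := by
  have h : ∀ a, dx a (dxi a (dx b (symb X))) =
      (if b = i then 1 else 0) + (if a = i then if a = b then 1 else 0 else 0) := by
    intro a
    rw [dx_dxi_comm, hX, map_add]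
    congr 1 <;> split_ifs <;> simp_all [dxi_X]
  simp only [divS_apply, h, Finset.sum_add_distrib, Finset.sum_const, Finset.card_univ,
    Fintype.card_fin, Finset.sum_ite_eq', Finset.mem_univ, if_true]
  rcases eq_or_ne b i with rfl | hb
  · simp [add_smul, Nat.cast_smul_eq_nsmul]
  · simp [hb, hb.symm]

/-- Here `D_{(x,η)}²` acts through Euler's identity in `ξ`. -/
lemma sum_dx_dx_symb_mul_quadratic (hX : ∀ a b, dx a (dx b (symb X)) =
    (if b = i then MvPolynomial.X a else 0) + (if a = i then MvPolynomial.X b else 0))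
    {m : ℕ} {P : S n} (hP : P.IsHomogeneous (m + 1)) :
    ∑ b, ∑ a, dx a (dx b (symb X)) * dxi a (dxi b P) = (2 * (m : ℝ)) • dxi i P := by
  have euler : ∑ a, MvPolynomial.X a * dxi a (dxi i P) = (m : ℝ) • dxi i P := by
    rw [Nat.cast_smul_eq_nsmul]
    exact (dxi_isHomogeneous i hP).sum_X_mul_pderiv
  simp only [hX, add_mul, ite_mul, zero_mul, Finset.sum_add_distrib, Finset.sum_ite_eq',
    Finset.mem_univ, if_true]
  rw [Finset.sum_comm]
  simp only [Finset.sum_ite_eq', Finset.mem_univ, if_true, dxi_comm i, euler]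
  module

end Quadratic

lemma onDiag_C₁_of_mem_slAlg {m : ℕ} {X : Vect n} (hX : X ∈ slAlg n) {P : S n}
    (hP : P.IsHomogeneous (m + 1)) : onDiag (C₁ n (m + 1)) (symb X) P = 0 := by
  refine induction_slAlg (p := fun X => onDiag (C₁ n (m + 1)) (symb X) P = 0)
    ?_ ?_ ?_ ?_ ?_ hX
  · simp [symb, onDiag, show ∀ i : Fin n, comp (0 : Vect n) i = 0 from fun _ => rfl]
  · intro X Y hX hY
    rw [symb_add, onDiag_add_left, hX, hY, add_zero]
  · intro c X hX
    rw [symb_smul, onDiag_smul_left, hX, smul_zero]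
  · intro X hX
    simp [onDiag_C₁_apply, divS_apply, dx_dxi_comm, hX]
  · intro X i hX
    rw [onDiag_C₁_apply, sum_dx_dx_symb_mul_quadratic hX hP]
    simp only [divS_dx_symb_quadratic hX, ite_mul, zero_mul, Finset.sum_ite_eq', Finset.mem_univ,
      if_true, smul_one_mul, smul_smul, ← sub_smul]
    have hn : (n : ℝ) + 1 ≠ 0 := by positivity
    rw [show (1 / 2 * (2 * (m : ℝ)) - (((m + 1 : ℕ) : ℝ) - 1) / (n + 1) * (n + 1)) = 0 by
      field_simp; push_cast; ring, zero_smul]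

lemma onDiag_C₂_of_mem_slAlg {m : ℕ} {X : Vect n} (hX : X ∈ slAlg n) {P : S n}
    (hP : P.IsHomogeneous (m + 2)) : onDiag (C₂ n (m + 2)) (symb X) P = 0 := by
  refine induction_slAlg (p := fun X => onDiag (C₂ n (m + 2)) (symb X) P = 0)
    ?_ ?_ ?_ ?_ ?_ hX
  · simp [symb, onDiag, show ∀ i : Fin n, comp (0 : Vect n) i = 0 from fun _ => rfl]
  · intro X Y hX hY
    rw [symb_add, onDiag_add_left, hX, hY, add_zero]
  · intro c X hX
    rw [symb_smul, onDiag_smul_left, hX, smul_zero]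
  · intro X hX
    have h : ∀ b, divS n (dx b (symb X)) = 0 := fun b => by
      simp [divS_apply, dx_dxi_comm, hX]
    simp [onDiag_C₂_apply, h, hX]
  · intro X i hX
    have h3 : ∀ a b c, dx a (dx b (dx c (symb X))) = 0 := by
      intro a b c
      rw [hX, map_add]
      split_ifs <;> simp [dx_X]
    have hd : ∀ a b, divS n (dx a (dx b (symb X))) = 0 := fun a b => by
      simp [divS_apply, dx_dxi_comm, h3]
    have hy : ∑ b, ∑ a, ∑ c, dxi c (dx a (dx b (symb X))) * dx c (dxi a (dxi b P)) =
        (2 : ℝ) • dxi i (divS n P) := by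
      have h : ∀ a b c, dxi c (dx a (dx b (symb X))) =
          (if b = i then if c = a then 1 else 0 else 0) +
            (if a = i then if c = b then 1 else 0 else 0) := by
        intro a b c
        rw [hX, map_add]
        congr 1 <;> split_ifs <;> simp_all [dxi_X]
      have h1 : ∀ c, dx c (dxi c (dxi i P)) = dxi i (dx c (dxi c P)) := by
        intro c
        rw [dxi_comm, dx_dxi_comm]
      have h2 : ∀ c, dx c (dxi i (dxi c P)) = dxi i (dx c (dxi c P)) := by
        intro c
        rw [dx_dxi_comm]
      simp only [h, add_mul, Finset.sum_add_distrib, ite_mul, zero_mul, one_mul]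
      rw [two_smul]
      congr 1
      · rw [Finset.sum_eq_single i (by intro b _ hb; simp [hb]) (by simp)]
        simp [h1, divS_apply]
      · refine (Finset.sum_congr rfl fun b _ =>
          Finset.sum_eq_single i (by intro a _ ha; simp [ha]) (by simp)).trans ?_
        simp [h2, divS_apply]
    rw [onDiag_C₂_apply, sum_dx_dx_symb_mul_quadratic hX (divS_isHomogeneous hP), hy]
    simp only [h3, hd, divS_dx_symb_quadratic hX, ite_mul, zero_mul, Finset.sum_ite_eq',
      Finset.mem_univ, if_true, smul_one_mul, Finset.sum_const_zero, smul_zero, add_zero,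
      smul_smul, ← add_smul]
    convert zero_smul ℝ (dxi i (divS n P)) using 2
    push_cast
    ring

/-! ### Operators commuting with affine vector fields -/

lemma lieS_field (f : Smooth n) (j : Fin n) (Q : S n) : lieS (field f j) Q =
    MvPolynomial.C f * dx j Q -
      MvPolynomial.X j * ∑ i, MvPolynomial.C (pd i f) * dxi i Q := by
  simp only [lieS_apply, symb_field, dxi_C_mul, dx_C_mul_X, dxi_X, Finset.sum_sub_distrib,
    Finset.mul_sum, mul_ite, mul_one, mul_zero, ite_mul, zero_mul, Finset.sum_ite_eq',
    Finset.mem_univ, if_true]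
  exact congrArg₂ (· - ·) rfl (Finset.sum_congr rfl fun i _ => by ring)

lemma lieS_field_one (j : Fin n) (Q : S n) : lieS (field 1 j) Q = dx j Q := by
  simp [lieS_field, pd_one]

lemma lieS_field_coord (i j : Fin n) (Q : S n) : lieS (field (coord i) j) Q =
    MvPolynomial.C (coord i) * dx j Q - MvPolynomial.X j * dxi i Q := by
  simp [lieS_field, pd_coord, apply_ite MvPolynomial.C, ite_mul]

lemma act_coe {k l : ℕ} (X : Vect n) (B : Sk n k →ₗ[ℝ] Sk n l) (P : Sk n k) :
    (act X B P : S n) = lieS X (B P) - (B (lieSk k X P) : S n) := rfl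

/-- Comparison of Euler degrees: an operator commuting with translations and dilations annihilates
a field `P` that is homogeneous of degree `w` in `x`, provided it annihilates the first derivatives
of `P` (so that `B P` has constant coefficients) and the degrees do not match. -/
lemma apply_eq_zero_of_euler {k l : ℕ} {B : Sk n k →ₗ[ℝ] Sk n l}
    (hB : ∀ X ∈ slAlg n, act X B = 0) {P : Sk n k} {w : ℕ}
    (hw : ∑ i, MvPolynomial.C (coord i) * dx i P.1 = (w : ℝ) • P.1)
    (hP : ∀ i, B (dxk k i P) = 0) (hne : w + l ≠ k) : B P = 0 := by
  have hcomm : ∀ X ∈ slAlg n, lieS X (B P) = (B (lieSk k X P) : S n) := by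
    intro X hX
    rw [← sub_eq_zero, ← act_coe, hB X hX]
    rfl
  -- Translation invariance: `B P` has constant coefficients.
  have hconst : ∀ i, dx i (B P).1 = 0 := by
    intro i
    rw [← lieS_field_one, hcomm _ (field_one_mem_slAlg i),
      show lieSk k (field 1 i) P = dxk k i P from Subtype.ext (lieS_field_one i _), hP]
    rfl
  -- The Euler field acts on `B P` by `-l`, and on `P` by `w - k`.
  have e1 : ∑ i, lieS (field (coord i) i) (B P).1 = -((l : ℝ) • (B P).1) := by
    simp only [lieS_field_coord, hconst, mul_zero, zero_sub, Finset.sum_neg_distrib]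
    rw [Nat.cast_smul_eq_nsmul]
    exact congrArg Neg.neg (B P).2.sum_X_mul_pderiv
  have e2 : ∑ i, lieSk k (field (coord i) i) P = ((w : ℝ) - k) • P := by
    apply Subtype.ext
    rw [AddSubmonoidClass.coe_finsetSum]
    change ∑ i, lieS (field (coord i) i) P.1 = ((w : ℝ) - k) • P.1
    have h : ∑ i, MvPolynomial.X i * dxi i P.1 = (k : ℝ) • P.1 := by
      rw [Nat.cast_smul_eq_nsmul]
      exact P.2.sum_X_mul_pderiv
    simp only [lieS_field_coord, Finset.sum_sub_distrib, hw, h, sub_smul]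
  have e3 : ∑ i, lieS (field (coord i) i) (B P).1 = ((w : ℝ) - k) • (B P).1 := by
    have h := congrArg (fun Q => (B Q : S n)) e2
    simp only [map_sum, map_smul] at h
    rw [AddSubmonoidClass.coe_finsetSum] at h
    rw [Finset.sum_congr rfl fun i _ => hcomm _ (field_coord_mem_slAlg i i), h]
    rfl
  have e4 : ((w : ℝ) + l - k) • (B P).1 = 0 := by
    rw [show (w : ℝ) + l - k = (w - k) + l by ring, add_smul, ← e3, e1, neg_add_cancel]
  rcases smul_eq_zero.1 e4 with h | h
  · exact absurd (by exact_mod_cast sub_eq_zero.1 h) hne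
  · exact Subtype.ext h

/-! ### Monomial test fields -/

lemma pd_coord_pow (a i : Fin n) (p : ℕ) :
    pd a (coord i ^ p) = (if a = i then (p : ℝ) else 0) • coord i ^ (p - 1) := by
  induction p with
  | zero => simp [pd_one]
  | succ p ih =>
    rw [pow_succ, pd_mul, ih, pd_coord]
    rcases eq_or_ne a i with rfl | h
    · rcases p with _ | p
      · simp
      · simp only [if_true, Nat.add_sub_cancel, smul_mul_assoc, ← pow_succ, mul_one]
        push_cast
        module
    · simp [h]

/-- The monomial `(x^i)^p ξ_i^q ξ_j^r`. -/
noncomputable def mono (i j : Fin n) (p q r : ℕ) : S n :=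
  MvPolynomial.C (coord i ^ p) * (MvPolynomial.X i ^ q * MvPolynomial.X j ^ r)

section Monomials

variable (i j : Fin n) (p q r p' q' r' : ℕ)

lemma mono_isHomogeneous : (mono i j p q r).IsHomogeneous (q + r) := by
  simpa [mono] using (MvPolynomial.isHomogeneous_C (Fin n) (coord i ^ p)).mul
    ((MvPolynomial.isHomogeneous_X_pow i q).mul (MvPolynomial.isHomogeneous_X_pow j r))

lemma mono_mul_mono :
    mono i j p q r * mono i j p' q' r' = mono i j (p + p') (q + q') (r + r') := by
  simp only [mono, pow_add, map_mul]
  ring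

lemma dx_X_pow (a i : Fin n) (q : ℕ) : dx a (MvPolynomial.X i ^ q : S n) = 0 := by
  induction q with
  | zero => simpa [pd_one] using dx_C a (1 : Smooth n)
  | succ q ih => rw [pow_succ, dx_mul, ih, dx_X, zero_mul, mul_zero, add_zero]

lemma C_smul (c : ℝ) (f : Smooth n) :
    (MvPolynomial.C (c • f) : S n) = c • MvPolynomial.C f := by
  apply MvPolynomial.ext
  intro m
  rw [MvPolynomial.coeff_smul, MvPolynomial.coeff_C, MvPolynomial.coeff_C]
  split_ifs <;> simp

lemma dx_mono (a : Fin n) : dx a (mono i j p q r) =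
    (if a = i then (p : ℝ) else 0) • mono i j (p - 1) q r := by
  rw [mono, dx_mul, dx_mul, dx_X_pow, dx_X_pow, dx_C, pd_coord_pow, mono]
  rw [C_smul, smul_mul_assoc, zero_mul, mul_zero, add_zero, mul_zero, add_zero]

lemma dxi_X_pow (a i : Fin n) (q : ℕ) : dxi a (MvPolynomial.X i ^ q : S n) =
    (if a = i then (q : ℝ) else 0) • MvPolynomial.X i ^ (q - 1) := by
  rw [show dxi a (MvPolynomial.X i ^ q : S n) = MvPolynomial.pderiv a (MvPolynomial.X i ^ q)
    from rfl, MvPolynomial.pderiv_pow]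
  change _ * dxi a (MvPolynomial.X i) = _
  rw [dxi_X]
  split_ifs
  · rw [mul_one, Nat.cast_smul_eq_nsmul, nsmul_eq_mul]
  · simp

lemma dxi_mono (a : Fin n) : dxi a (mono i j p q r) =
    (if a = i then (q : ℝ) else 0) • mono i j p (q - 1) r +
      (if a = j then (r : ℝ) else 0) • mono i j p q (r - 1) := by
  rw [mono, dxi_C_mul, dxi_mul, dxi_X_pow, dxi_X_pow, mono, mono, mul_add, smul_mul_assoc,
    mul_smul_comm, mul_smul_comm, mul_smul_comm]

lemma mono_zero_ne_zero : mono i j 0 q r ≠ 0 := by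
  have : Nontrivial (Smooth n) := by
    refine ⟨0, 1, fun h => ?_⟩
    have h' : (0 : Smooth n).1 0 = (1 : Smooth n).1 0 := by rw [h]
    exact zero_ne_one (α := ℝ) h'
  rw [mono, pow_zero, map_one, one_mul]
  intro h
  have h' := congrArg (MvPolynomial.eval fun _ => (1 : Smooth n)) h
  simp at h'

lemma symb_field_left : symb (field (coord i ^ p) i) = mono i j p 1 0 := by
  simp [symb_field, mono]

lemma symb_field_right : symb (field (coord i ^ p) j) = mono i j p 0 1 := by
  simp [symb_field, mono]

lemma euler_mono : ∑ a, MvPolynomial.C (coord a) * dx a (mono i j p q r) =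
    (p : ℝ) • mono i j p q r := by
  simp only [dx_mono, ite_smul, zero_smul, mul_ite, mul_zero, Finset.sum_ite_eq', Finset.mem_univ,
    if_true]
  rcases p with _ | p
  · simp
  · rw [mul_smul_comm, Nat.add_sub_cancel, mono, mono, ← mul_assoc, ← map_mul, ← pow_succ']

end Monomials

/-! ### The classes are not trivial -/

lemma dx_ite (a : Fin n) (p : Prop) [Decidable p] (P : S n) :
    dx a (if p then P else 0) = if p then dx a P else 0 := by
  split_ifs <;> simp

lemma dxi_ite (a : Fin n) (p : Prop) [Decidable p] (P : S n) :
    dxi a (if p then P else 0) = if p then dxi a P else 0 := by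
  split_ifs <;> simp

section Tests

variable {i j : Fin n} (m : ℕ)

lemma onDiag_C₁_test_left :
    onDiag (C₁ n (m + 2)) (mono i j 2 1 0) (mono i j 0 (m + 2) 0) =
      (((m : ℝ) + 2) * (m + 1) * (1 - 2 / (n + 1))) • mono i j 0 (m + 1) 0 := by
  simp [onDiag_C₁_apply, divS_apply, dx_mono, dxi_mono, mono_mul_mono, dx_ite, dxi_ite, smul_smul]
  rw [add_comm 1 m, ← sub_smul]
  congr 1
  field_simp
  ring

lemma onDiag_C₁_test_right (hij : i ≠ j) :
    onDiag (C₁ n (m + 2)) (mono i j 2 0 1) (mono i j 0 (m + 2) 0) =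
      (((m : ℝ) + 2) * (m + 1)) • mono i j 0 m 1 := by
  simp [onDiag_C₁_apply, divS_apply, dx_mono, dxi_mono, mono_mul_mono, hij.symm,
    dx_ite, dxi_ite, smul_smul]
  module

/-- The exponent `1 + (m - 1)` differs from `m` only for `m = 0`, where the coefficient vanishes. -/
lemma mono_one_add_sub_one (a : ℝ) : (a * m) • mono i j 0 (1 + (m - 1)) 0 =
    (a * m) • mono i j 0 m 0 := by
  rcases m with _ | m
  · simp
  · rw [Nat.add_sub_cancel, add_comm 1 m]

lemma onDiag_C₂_test_constant :
    onDiag (C₂ n (m + 2)) (mono i j 3 1 0) (mono i j 0 (m + 2) 0) =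
      (((m : ℝ) + 2) * (m + 1) * ((2 * m + n + 5) * m + 6)) • mono i j 0 m 0 := by
  have h := mono_one_add_sub_one (i := i) (j := j) m
    ((2 * ((m : ℝ) + 2) + n + 1) / 6 * ((m + 2) * (m + 1) * (3 * 2)))
  simp [onDiag_C₂_apply, divS_apply, dx_mono, dxi_mono, mono_mul_mono,
    dx_ite, dxi_ite, smul_smul]
  linear_combination (norm := module) h

lemma onDiag_C₂_test_linear :
    onDiag (C₂ n (m + 2)) (mono i j 2 1 0) (mono i j 1 (m + 2) 0) =
      (((m : ℝ) + 2) * (m + 1) * (1 - n)) • mono i j 0 m 0 := by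
  have h := mono_one_add_sub_one (i := i) (j := j) m (((m : ℝ) + 2) * (m + 1) * 2)
  simp [onDiag_C₂_apply, divS_apply, dx_mono, dxi_mono, mono_mul_mono,
    dx_ite, dxi_ite, smul_smul]
  linear_combination (norm := module) h

/-- The monomial `(x^i)^p ξ_i^q ξ_j^r` as an element of `𝒮_k`. -/
noncomputable def monoSk {k : ℕ} (i j : Fin n) (p q r : ℕ) (h : q + r = k) : Sk n k :=
  ⟨mono i j p q r, h ▸ mono_isHomogeneous i j p q r⟩

lemma apply_monoSk_zero {k l : ℕ} {B : Sk n k →ₗ[ℝ] Sk n l} (hB : ∀ X ∈ slAlg n, act X B = 0)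
    (hl : l ≠ k) {q r : ℕ} (h : q + r = k) : B (monoSk i j 0 q r h) = 0 := by
  refine apply_eq_zero_of_euler hB (w := 0) (euler_mono i j 0 q r) (fun a => ?_) (by simpa using hl)
  rw [show dxk k a (monoSk i j 0 q r h) = 0 from Subtype.ext (by
    change dx a (mono i j 0 q r) = 0
    simp [dx_mono]), map_zero]

lemma apply_monoSk_one {k l : ℕ} {B : Sk n k →ₗ[ℝ] Sk n l} (hB : ∀ X ∈ slAlg n, act X B = 0)
    (hl : l ≠ k) (hl' : 1 + l ≠ k) {q r : ℕ} (h : q + r = k) : B (monoSk i j 1 q r h) = 0 := by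
  refine apply_eq_zero_of_euler hB (w := 1) (euler_mono i j 1 q r) (fun a => ?_) hl'
  rw [show dxk k a (monoSk i j 1 q r h) = (if a = i then (1 : ℝ) else 0) • monoSk i j 0 q r h from
    Subtype.ext (by
      change dx a (mono i j 1 q r) = (if a = i then (1 : ℝ) else 0) • mono i j 0 q r
      simp [dx_mono]), map_smul, apply_monoSk_zero hB hl, smul_zero]

/-- A primitive `B` of `c₁` commutes with `sl(n+1, ℝ)`. Its values on `x^i ξ_i^k` and
`x^i ξ_i^{k-1} ξ_j` are then determined by the cocycle, and incompatible with `B` commuting with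
`x^i ∂/∂x^j`. -/
lemma not_coboundary_C₁ (hij : i ≠ j) (B : Sk n (m + 2) →ₗ[ℝ] Sk n (m + 1))
    (hB : ∀ (X : Vect n) (P : Sk n (m + 2)),
      (act X B P : S n) = onDiag (C₁ n (m + 2)) (symb X) P) : False := by
  have hsl : ∀ X ∈ slAlg n, act X B = 0 := fun X hX =>
    LinearMap.ext fun P => Subtype.ext ((hB X P).trans (onDiag_C₁_of_mem_slAlg hX P.2))
  set P₀ : Sk n (m + 2) := monoSk i j 0 (m + 2) 0 rfl
  set P₁ : Sk n (m + 2) := monoSk i j 1 (m + 2) 0 rfl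
  set P₂ : Sk n (m + 2) := monoSk i j 1 (m + 1) 1 rfl
  have h0 : B P₀ = 0 := apply_monoSk_zero hsl (by omega) _
  have l1 : lieSk (m + 2) (field (coord i ^ 2) i) P₀ = (-(2 * ((m : ℝ) + 2))) • P₁ := by
    apply Subtype.ext
    change lieS _ (mono i j 0 (m + 2) 0) = (-(2 * ((m : ℝ) + 2))) • mono i j 1 (m + 2) 0
    rw [lieS_apply, symb_field_left i j]
    simp [dx_mono, dxi_mono, mono_mul_mono, smul_smul, add_comm 1]
    module
  have l2 : lieSk (m + 2) (field (coord i ^ 2) j) P₀ = (-(2 * ((m : ℝ) + 2))) • P₂ := by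
    apply Subtype.ext
    change lieS _ (mono i j 0 (m + 2) 0) = (-(2 * ((m : ℝ) + 2))) • mono i j 1 (m + 1) 1
    rw [lieS_apply, symb_field_right i j]
    simp [dx_mono, dxi_mono, mono_mul_mono, smul_smul]
    module
  have l3 : lieSk (m + 2) (field (coord i) j) P₁ = (-((m : ℝ) + 2)) • P₂ := by
    apply Subtype.ext
    change lieS _ (mono i j 1 (m + 2) 0) = (-((m : ℝ) + 2)) • mono i j 1 (m + 1) 1
    rw [lieS_apply, ← pow_one (coord i), symb_field_right i j]
    simp [dx_mono, dxi_mono, mono_mul_mono, hij]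
    module
  have e1 := hB (field (coord i ^ 2) i) P₀
  have e2 := hB (field (coord i ^ 2) j) P₀
  have e3 := congrArg (fun T => (T P₁ : S n)) (hsl _ (field_coord_mem_slAlg i j))
  rw [act_coe, h0, l1, map_smul, symb_field_left i j] at e1
  rw [act_coe, h0, l2, map_smul, symb_field_right i j] at e2
  simp only [act_coe] at e3
  rw [l3, map_smul] at e3
  have f1 : (2 * ((m : ℝ) + 2)) • (B P₁ : S n) =
      (((m : ℝ) + 2) * (m + 1) * (1 - 2 / (n + 1))) • mono i j 0 (m + 1) 0 := by
    rw [← onDiag_C₁_test_left m]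
    refine Eq.trans ?_ e1
    change _ = lieS _ 0 - (-(2 * ((m : ℝ) + 2))) • (B P₁ : S n)
    rw [map_zero]
    module
  have f2 : (2 * ((m : ℝ) + 2)) • (B P₂ : S n) =
      (((m : ℝ) + 2) * (m + 1)) • mono i j 0 m 1 := by
    rw [← onDiag_C₁_test_right m hij]
    refine Eq.trans ?_ e2
    change _ = lieS _ 0 - (-(2 * ((m : ℝ) + 2))) • (B P₂ : S n)
    rw [map_zero]
    module
  have f3 : lieS (field (coord i) j) (B P₁ : S n) = -((m : ℝ) + 2) • (B P₂ : S n) :=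
    sub_eq_zero.1 e3
  have l4 : lieS (field (coord i) j) (mono i j 0 (m + 1) 0) =
      (-((m : ℝ) + 1)) • mono i j 0 m 1 := by
    rw [lieS_apply, ← pow_one (coord i), symb_field_right i j]
    simp [dx_mono, dxi_mono, mono_mul_mono]
    module
  have f4 := congrArg (lieS (field (coord i) j)) f1
  rw [map_smul, map_smul, f3, l4, smul_comm, f2, smul_smul, smul_smul, ← sub_eq_zero,
    ← sub_smul] at f4
  -- The coefficients of `ξ_i^{k-2} ξ_j` give `(k-1)(1 - 2/(n+1)) = k`.
  have f5 := (smul_eq_zero.1 f4).resolve_right (mono_zero_ne_zero i j m 1)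
  have hn : (0 : ℝ) < n + 1 := by positivity
  have hm : (0 : ℝ) ≤ m := by positivity
  have hd : 0 < 2 / ((n : ℝ) + 1) := by positivity
  have f6 : ((m : ℝ) + 2) * (m + 1) * ((m + 1) * (1 - 2 / (n + 1)) - (m + 2)) = 0 := by
    linear_combination f5
  have f7 : ((m : ℝ) + 1) * (1 - 2 / (n + 1)) - (m + 2) < 0 := by nlinarith
  have f8 : ((m : ℝ) + 2) * (m + 1) ≠ 0 := by positivity
  exact f7.ne ((mul_eq_zero.1 f6).resolve_left f8)

/-- A primitive `B` of `c₂` commutes with `sl(n+1, ℝ)`. Two evaluations of the cocycle give values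
of opposite signs for `B` on `(x^i)² ξ_i^k`. -/
lemma not_coboundary_C₂ (i j : Fin n) (hn : 2 ≤ n) (B : Sk n (m + 2) →ₗ[ℝ] Sk n m)
    (hB : ∀ (X : Vect n) (P : Sk n (m + 2)),
      (act X B P : S n) = onDiag (C₂ n (m + 2)) (symb X) P) : False := by
  have hsl : ∀ X ∈ slAlg n, act X B = 0 := fun X hX =>
    LinearMap.ext fun P => Subtype.ext ((hB X P).trans (onDiag_C₂_of_mem_slAlg hX P.2))
  set P₀ : Sk n (m + 2) := monoSk i j 0 (m + 2) 0 rfl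
  set P₁ : Sk n (m + 2) := monoSk i j 1 (m + 2) 0 rfl
  set P₂ : Sk n (m + 2) := monoSk i j 2 (m + 2) 0 rfl
  have h0 : B P₀ = 0 := apply_monoSk_zero hsl (by omega) _
  have h1 : B P₁ = 0 := apply_monoSk_one hsl (by omega) (by omega) _
  have l1 : lieSk (m + 2) (field (coord i ^ 3) i) P₀ = (-(3 * ((m : ℝ) + 2))) • P₂ := by
    apply Subtype.ext
    change lieS _ (mono i j 0 (m + 2) 0) = (-(3 * ((m : ℝ) + 2))) • mono i j 2 (m + 2) 0
    rw [lieS_apply, symb_field_left i j]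
    simp [dx_mono, dxi_mono, mono_mul_mono, smul_smul, add_comm 1]
    module
  have l2 : lieSk (m + 2) (field (coord i ^ 2) i) P₁ = (-(2 * (m : ℝ) + 3)) • P₂ := by
    apply Subtype.ext
    change lieS _ (mono i j 1 (m + 2) 0) = (-(2 * (m : ℝ) + 3)) • mono i j 2 (m + 2) 0
    rw [lieS_apply, symb_field_left i j]
    simp [dx_mono, dxi_mono, mono_mul_mono, smul_smul, add_comm 1]
    module
  have e1 := hB (field (coord i ^ 3) i) P₀
  have e2 := hB (field (coord i ^ 2) i) P₁
  rw [act_coe, h0, l1, map_smul, symb_field_left i j] at e1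
  rw [act_coe, h1, l2, map_smul, symb_field_left i j] at e2
  have f1 : (3 * ((m : ℝ) + 2)) • (B P₂ : S n) =
      (((m : ℝ) + 2) * (m + 1) * ((2 * m + n + 5) * m + 6)) • mono i j 0 m 0 := by
    rw [← onDiag_C₂_test_constant m]
    refine Eq.trans ?_ e1
    change _ = lieS _ 0 - (-(3 * ((m : ℝ) + 2))) • (B P₂ : S n)
    rw [map_zero]
    module
  have f2 : (2 * (m : ℝ) + 3) • (B P₂ : S n) =
      (((m : ℝ) + 2) * (m + 1) * (1 - n)) • mono i j 0 m 0 := by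
    rw [← onDiag_C₂_test_linear m]
    refine Eq.trans ?_ e2
    change _ = lieS _ 0 - (-(2 * (m : ℝ) + 3)) • (B P₂ : S n)
    rw [map_zero]
    module
  -- `f1` makes the coefficient of `B P₂` positive, `f2` makes it negative.
  have f3 := congrArg ((2 * (m : ℝ) + 3) • ·) f1
  rw [smul_comm, f2, smul_smul, smul_smul, ← sub_eq_zero, ← sub_smul] at f3
  have f4 := (smul_eq_zero.1 f3).resolve_right (mono_zero_ne_zero i j m 0)
  have hn' : (2 : ℝ) ≤ n := by exact_mod_cast hn
  have hm : (0 : ℝ) ≤ m := by positivity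
  have f5 : ((m : ℝ) + 2) * (m + 1) *
      (3 * (m + 2) * (n - 1) + (2 * m + 3) * ((2 * m + n + 5) * m + 6)) = 0 := by
    linear_combination -f4
  have f6 : 0 ≤ 3 * ((m : ℝ) + 2) * (n - 1) := mul_nonneg (by positivity) (by linarith)
  have f7 : 0 < (2 * (m : ℝ) + 3) * ((2 * m + n + 5) * m + 6) := by positivity
  have f8 : ((m : ℝ) + 2) * (m + 1) ≠ 0 := by positivity
  exact (add_pos_of_nonneg_of_pos f6 f7).ne' ((mul_eq_zero.1 f5).resolve_left f8)

end Tests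

/-- The linear map from vector fields to differential operators given by a bidifferential operator
whose values restrict to differential operators. -/
noncomputable def cochain {k l : ℕ} (T : Module.End ℝ (S n ⊗[ℝ] S n))
    (hT : ∀ X : Vect n, RestrictsToDiffOp k l (onDiag T (symb X))) :
    Vect n →ₗ[ℝ] DiffOp n k l where
  toFun X := ⟨(hT X).choose, (hT X).choose_spec.1⟩
  map_add' X Y := Subtype.ext <| LinearMap.ext fun P => Subtype.ext <| by
    change ((hT (X + Y)).choose P : S n) = (hT X).choose P + (hT Y).choose P
    rw [(hT (X + Y)).choose_spec.2, (hT X).choose_spec.2, (hT Y).choose_spec.2, symb_add,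
      onDiag_add_left]
  map_smul' c X := Subtype.ext <| LinearMap.ext fun P => Subtype.ext <| by
    change ((hT (c • X)).choose P : S n) = c • ((hT X).choose P : S n)
    rw [(hT (c • X)).choose_spec.2, (hT X).choose_spec.2, symb_smul, onDiag_smul_left]

lemma cochain_apply {k l : ℕ} (T : Module.End ℝ (S n ⊗[ℝ] S n))
    (hT : ∀ X : Vect n, RestrictsToDiffOp k l (onDiag T (symb X))) (X : Vect n) (P : Sk n k) :
    ((cochain T hT X).1 P : S n) = onDiag T (symb X) P :=
  (hT X).choose_spec.2 P

lemma isOneCocycle_cochain {k l : ℕ} {T : Module.End ℝ (S n ⊗[ℝ] S n)}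
    (hT : ∀ X : Vect n, RestrictsToDiffOp k l (onDiag T (symb X)))
    (h : ∀ (X Y : Vect n) (P : S n), onDiag T (symb ⁅X, Y⁆) P =
      (lieS X (onDiag T (symb Y) P) - onDiag T (symb Y) (lieS X P)) -
        (lieS Y (onDiag T (symb X) P) - onDiag T (symb X) (lieS Y P))) :
    IsOneCocycle (cochain T hT) := by
  intro X Y
  refine LinearMap.ext fun P => Subtype.ext ?_
  change ((cochain T hT ⁅X, Y⁆).1 P : S n) =
    (act X (cochain T hT Y).1 P : S n) - (act Y (cochain T hT X).1 P : S n)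
  simp only [act_coe, cochain_apply]
  exact h X Y P

lemma cochain_eq_zero {k l : ℕ} {T : Module.End ℝ (S n ⊗[ℝ] S n)}
    (hT : ∀ X : Vect n, RestrictsToDiffOp k l (onDiag T (symb X))) {X : Vect n}
    (h : ∀ P : Sk n k, onDiag T (symb X) P = 0) : cochain T hT X = 0 :=
  Subtype.ext <| LinearMap.ext fun P => Subtype.ext <| (cochain_apply T hT X P).trans (h P)

end ProjCocycle

open ProjCocycle in
theorem proposition3p8 (n k : ℕ) (hn : 2 ≤ n) (hk : 2 ≤ k) :
    (∃ c : Vect n →ₗ[ℝ] DiffOp n k (k - 1),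
      (∀ (X : Vect n) (P : Sk n k), (((c X).1 P : Sk n (k - 1)) : S n) =
        onDiag (C₁ n k) (symb X) P) ∧
      IsOneCocycle c ∧ (∀ X ∈ slAlg n, c X = 0) ∧ ¬ IsOneCoboundary c) ∧
    (∃ c : Vect n →ₗ[ℝ] DiffOp n k (k - 2),
      (∀ (X : Vect n) (P : Sk n k), (((c X).1 P : Sk n (k - 2)) : S n) =
        onDiag (C₂ n k) (symb X) P) ∧
      IsOneCocycle c ∧ (∀ X ∈ slAlg n, c X = 0) ∧ ¬ IsOneCoboundary c) := by
  obtain ⟨m, rfl⟩ : ∃ m, k = m + 2 := ⟨k - 2, by omega⟩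
  have hij : (⟨0, by omega⟩ : Fin n) ≠ ⟨1, by omega⟩ := by simp
  refine ⟨⟨cochain (C₁ n (m + 2)) (restrictsToDiffOp_C₁ rfl), cochain_apply _ _,
      isOneCocycle_cochain _ fun X Y P => onDiag_C₁_bracket X Y P _,
      fun X hX => cochain_eq_zero _ fun P => onDiag_C₁_of_mem_slAlg hX P.2, ?_⟩,
    ⟨cochain (C₂ n (m + 2)) (restrictsToDiffOp_C₂ rfl), cochain_apply _ _,
      isOneCocycle_cochain _ fun X Y P => onDiag_C₂_bracket X Y P _,
      fun X hX => cochain_eq_zero _ fun P => onDiag_C₂_of_mem_slAlg hX P.2, ?_⟩⟩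
  · rintro ⟨B, hB⟩
    exact not_coboundary_C₁ m hij B.1 fun X P => by rw [← hB X, cochain_apply]
  · rintro ⟨B, hB⟩
    exact not_coboundary_C₂ m ⟨0, by omega⟩ ⟨1, by omega⟩ hn B.1 fun X P => by rw [← hB X, cochain_apply]
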